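/- Let $S$ be a finite set and, for $i\in S$, let $\mathcal U_i=\{0,1,\dots,d(i)\}$ be the set of actions available in state $i$. Let $A_{ij}(a)\ge 0$ ($i,j\in S$, $a\in\mathcal U_i$), with $\sum_j A_{ij}(a)=1$, be the transition probabilities of a Markov decision process, and let $c(i,a)\in\mathbb R$ be a cost function. For angles $\alpha=(\alpha_{ip})_{i\in S,\,1\le p\le d(i)}$ define the randomized policy $\theta_{ia}(\alpha)=\lambda_{ia}^2$, where $$\lambda_{ia}=\cos(\alpha_{i,a+1})\prod_{k=1}^{a}\sin(\alpha_{ik})\quad(0\le a<d(i)),\qquad \lambda_{i,d(i)}=\prod_{k=1}^{d(i)}\sin(\alpha_{ik}),$$ and let $\boldsymbol\alpha^o$ be the interior of $\boldsymbol\alpha=\{\alpha:\ \alpha_{ip}\in[0,\pi/2]\ \text{for all } i,p\}$. Let $P(\alpha)$ be the transition matrix on the state-action pairs $(i,a)$, $a\in\mathcal U_i$, with entries $P_{(i,a),(j,a')}(\alpha)=\theta_{ja'}(\alpha)A_{ij}(a)$. Assume that the process is ergodic, in the sense that $P(\alpha)$ is irreducible for every $\alpha\in\boldsymbol\alpha^o$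 (this holds in particular if all $A_{ij}(a)$ are positive). Then for every $\alpha\in\boldsymbol\alpha^o$ the matrix $P(\alpha)$ has a unique invariant probability vector $\pi(\alpha)$; put $C(\alpha)=\sum_{i,a}\pi_{ia}(\alpha)c(i,a)$. Fix $\alpha\in\boldsymbol\alpha^o$ and let $Z_n=(X_n,u_n)$, $n\ge0$, be a Markov chain with transition matrix $P(\alpha)$ and any initial law. Then $C$ is differentiable at $\alpha$, and $\frac1N\sum_{n=1}^N c(Z_n)\to C(\alpha)$ almost surely. Moreover, fix $i\in S$ and $p\in\{1,\dots,d(i)\}$. Let $(Y_{p,k})_k$ be i.i.d. random variables (phantom actions), independent of the process $(Z_n)$, with law $$\mathbb P(Y_{p,k}=a)=\frac{\theta_{ia}(\alpha)}{\prod_{m=1}^{p}\sin^2(\alpha_{im})}\quad\text{for } p\le a\le d(i),\qquad \mathbb P(Y_{p,k}=a)=0\quad\text{for } a<p .$$ Put $$\tilde u_k=\begin{cases}Y_{p,k}, & p<d(i),\\ d(i)\,\mathbf 1\{u_k=d(i)-1\}+(d(i)-1)\,\mathbf 1\{u_k=d(i)\}, & p=d(i),\end{cases}\qquad \nu(k)=\min\{n>0:\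 Z_{k+n}=(i,\tilde u_k)\},$$ $$K_{ip}(\alpha,k)=\begin{cases}-\tan(\alpha_{ip})\,\mathbf 1\{Z_k=(i,p-1)\}, & p<d(i),\\ -\cos(\alpha_{ip})\sin(\alpha_{ip})\big[\mathbf 1\{Z_k=(i,d(i)-1)\}-\mathbf 1\{Z_k=(i,d(i))\}\big], & p=d(i).\end{cases}$$ Then, almost surely, $\nu(k)<\infty$ for all $k$. Let $\hat\Gamma_N$ be any sequence of real random variables with $\hat\Gamma_N\to C(\alpha)$ almost surely (for example $\hat\Gamma_N=\frac1N\sum_{n=1}^N c(Z_n)$). Then the estimator $$\hat G_N(i,p)=\frac2N\sum_{k=1}^N K_{ip}(\alpha,k)\Big([c(i,u_k)-c(i,\tilde u_k)]+\sum_{n=k+1}^{k+\nu(k)}c(Z_n)-\nu(k)\,\hat\Gamma_N\Big),$$ whose formula does not involve the transition probabilities $A_{ij}(a)$, is consistent: $$\hat G_N(i,p)\longrightarrow\frac{\partial C}{\partial\alpha_{ip}}(\alpha)\quad\text{almost surely as } N\to\infty .$$ (Terms with $K_{ip}(\alpha,k)=0$ are read as $0$.) -/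

import Mathlib

open MeasureTheory ProbabilityTheory Filter Topology

/-- A finite Markov decision process on the state space `S`. The actions available in state `i` are
`0, …, d i`, and `A i u j` is the probability of moving from `i` to `j` under action `u`. -/
structure MDP (S : Type*) [Fintype S] (d : S → ℕ) where
  A : (i : S) → Fin (d i + 1) → S → ℝ
  A_nonneg : ∀ i u j, 0 ≤ A i u j
  A_sum : ∀ i u, ∑ j, A i u j = 1

namespace MDP

/-- State-action pairs `(i, a)` with `a ∈ {0, …, d i}`. -/
abbrev StateAction {S : Type*} (d : S → ℕ) : Type _ := (i : S) × Fin (d i + 1)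

/-- Families of spherical coordinates `α_{ip}`, `1 ≤ p ≤ d(i)`.
The entry `α i p` with `p : Fin (d i)` is the angle usually numbered `p + 1`. -/
abbrev Angles {S : Type*} (d : S → ℕ) : Type _ := (i : S) → Fin (d i) → ℝ

/-- The compact set of angles in `[0, π/2]`. -/
def angleBox {S : Type*} (d : S → ℕ) : Set (Angles d) :=
  {α | ∀ i p, α i p ∈ Set.Icc 0 (Real.pi / 2)}

section Policy

variable {S : Type*} {d : S → ℕ}

/-- `λ_{ia} = cos α_{i,a+1} ∏_{k ≤ a} sin α_{ik}` for `a < d(i)`, and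
`λ_{i,d(i)} = ∏_{k ≤ d(i)} sin α_{ik}`. -/
noncomputable def sphericalCoord (α : Angles d) (i : S) (a : Fin (d i + 1)) : ℝ :=
  (if h : (a : ℕ) < d i then Real.cos (α i ⟨a, h⟩) else 1) *
    ∏ k ∈ Finset.univ.filter (fun k : Fin (d i) => (k : ℕ) < a), Real.sin (α i k)

/-- The spherically parameterized randomized policy `θ_{ia}(α) = λ_{ia}²`: the probability of
choosing action `a` in state `i`. -/
noncomputable def policy (α : Angles d) (i : S) (a : Fin (d i + 1)) : ℝ :=
  sphericalCoord α i a ^ 2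

/-- The law of the phantom action `Y_p`: the policy in state `i` restricted to the actions numbered
at least `p`, i.e. `θ_{ia}(α) / ∏_{m = 1}^{p} sin² α_{im}` for `a ≥ p`, and `0` for `a < p`. -/
noncomputable def phantomLaw (α : Angles d) (i : S) (p : Fin (d i)) (a : Fin (d i + 1)) : ℝ :=
  if p.succ ≤ a then policy α i a / ∏ m ∈ Finset.Iic p, Real.sin (α i m) ^ 2 else 0

variable [DecidableEq S]

/-- `δ_{ia}`: the indicator that the current state-action pair is `(i, a)`. -/
def visit (i : S) (a : Fin (d i + 1)) (z : StateAction d) : ℝ :=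
  if z = ⟨i, a⟩ then 1 else 0

/-- The weighting factor `K_{ip}(α, k)` as a function of the pair `z = Z_k`. -/
noncomputable def weight (α : Angles d) (i : S) (p : Fin (d i)) (z : StateAction d) : ℝ :=
  if (p : ℕ) + 1 < d i then - Real.tan (α i p) * visit i p.castSucc z
  else - (Real.cos (α i p) * Real.sin (α i p)) * (visit i p.castSucc z - visit i p.succ z)

/-- The action `ũ_k` of the phantom started from the pair `z = Z_k`, where `y` is the sampled value
of `Y_p`: it is `y` if `p < d(i)`; if `p = d(i)` it exchanges the actions `d(i) - 1` and `d(i)`,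
and is `0` on every other action. -/
def phantomAction (i : S) (p : Fin (d i)) (z : StateAction d) (y : Fin (d i + 1)) :
    Fin (d i + 1) :=
  if (p : ℕ) + 1 < d i then y
  else if (z.2 : ℕ) = p then p.succ
  else if (z.2 : ℕ) = p + 1 then p.castSucc
  else 0

/-- The set of times `n > 0` at which `Z_{k+n} = (i, ũ_k)`. -/
def hittingSet (i : S) (p : Fin (d i)) (z : ℕ → StateAction d) (y : ℕ → Fin (d i + 1)) (k : ℕ) :
    Set ℕ :=
  {n | 0 < n ∧ z (k + n) = ⟨i, phantomAction i p (z k) (y k)⟩}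

/-- The hitting time `ν(k) = min {n > 0 : Z_{k+n} = (i, ũ_k)}`. -/
noncomputable def hittingTime (i : S) (p : Fin (d i)) (z : ℕ → StateAction d)
    (y : ℕ → Fin (d i + 1)) (k : ℕ) : ℕ :=
  sInf (hittingSet i p z y k)

/-- The WD phantom estimator `Ĝ_N(i, p)`, computed from the parameter `α`, the cost function `c`,
the observed trajectory `z`, the sampled phantom actions `y` and an estimate `Γ` of the cost.
It does not involve the transition probabilities. (The factor `weight` vanishes unless the state of
`z k` is `i`, so that `c (z k)` is `c(i, u_k)` in every term that contributes.) -/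
noncomputable def wdPhantom (α : Angles d) (c : StateAction d → ℝ) (i : S) (p : Fin (d i))
    (z : ℕ → StateAction d) (y : ℕ → Fin (d i + 1)) (Γ : ℝ) (N : ℕ) : ℝ :=
  2 / (N : ℝ) * ∑ k ∈ Finset.Icc 1 N, weight α i p (z k) *
    ((c (z k) - c ⟨i, phantomAction i p (z k) (y k)⟩)
      + ∑ n ∈ Finset.Ioc k (k + hittingTime i p z y k), c (z n)
      - (hittingTime i p z y k : ℝ) * Γ)

end Policy

section Chain

variable {S : Type*} [Fintype S] {d : S → ℕ}

/-- The transition matrix of `Z_n = (X_n, u_n)`: from `(i, a)` to `(j, a')` with probability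
`θ_{ja'}(α) A_{ij}(a)`. -/
noncomputable def kernel (M : MDP S d) (α : Angles d) :
    Matrix (StateAction d) (StateAction d) ℝ :=
  fun z w => policy α w.1 w.2 * M.A z.1 z.2 w.1

/-- The chain of state-action pairs is irreducible for each parameter in the interior of the
parameter set. -/
def IsErgodic (M : MDP S d) : Prop :=
  ∀ α ∈ interior (angleBox d), (M.kernel α).IsIrreducible

/-- `ϖ` is an invariant probability vector of the chain with parameter `α`. -/
def IsInvariant (M : MDP S d) (α : Angles d) (ϖ : StateAction d → ℝ) : Prop :=
  ϖ ∈ stdSimplex ℝ (StateAction d) ∧ Matrix.vecMul ϖ (M.kernel α) = ϖ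

/-- The invariant probability vector `π(α)`. -/
noncomputable def statDist (M : MDP S d) (α : Angles d) : StateAction d → ℝ :=
  Classical.epsilon (M.IsInvariant α)

/-- The stationary expected cost `C(α) = ∑_{i,a} π_{ia}(α) c(i, a)`. -/
noncomputable def statCost (M : MDP S d) (c : StateAction d → ℝ) (α : Angles d) : ℝ :=
  ∑ z, M.statDist α z * c z

/-- `Z` is a Markov chain with transition matrix `kernel α` (and an arbitrary initial law). -/
def IsTrajectory (M : MDP S d) (α : Angles d) {Ω : Type*} [MeasurableSpace Ω]
    (μ : Measure Ω) (Z : ℕ → Ω → StateAction d) : Prop :=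
  (∀ n, Measurable (Z n)) ∧
  ∀ (n : ℕ) (z : ℕ → StateAction d),
    μ.real {ω | ∀ m ≤ n + 1, Z m ω = z m} =
      μ.real {ω | ∀ m ≤ n, Z m ω = z m} * M.kernel α (z n) (z (n + 1))

end Chain

/-- `Y 0, Y 1, …` are independent, each with the law of the phantom action `Y_p`, and the sequence
is independent of the trajectory `Z`. -/
def IsPhantomSequence {S : Type*} {d : S → ℕ} (α : Angles d) (i : S) (p : Fin (d i))
    {Ω : Type*} [MeasurableSpace Ω] (μ : Measure Ω) (Z : ℕ → Ω → StateAction d)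
    (Y : ℕ → Ω → Fin (d i + 1)) : Prop :=
  (∀ k, Measurable (Y k)) ∧
  (∀ k a, μ.real {ω | Y k ω = a} = phantomLaw α i p a) ∧
  iIndepFun Y μ ∧
  IndepFun (fun ω k => Y k ω) (fun ω n => Z n ω) μ

end MDP

/-!
Let `h` solve the Poisson equation `h - P h = c - C` of `P = P(α)`. Then `c (Z n) - C` is a
martingale difference up to a telescoping term, which gives the law of large numbers. If `ϖ'` is
stationary for `P(β)`, then `C(β) = C + ϖ' ⬝ᵥ (P(β) - P) *ᵥ h`, so the derivative of `C` at `α` is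
`ϖ ⬝ᵥ (∂P) *ᵥ h`. For `p < d(i)` the derivative of `θ_i` along `α_{ip}` is
`-2 tan(α_{ip}) θ_{i,p-1}` times the difference of the point mass at `p - 1` and the law of
`Y_{p,k}`, and for `p = d(i)` it moves mass between the last two actions. The expected total of
`c - C` over the excursion from `z` to its first return to `w` is `h z - h w` plus the boundary term
`c w - c z`, so each summand of the estimator has conditional mean `K (h (Z k) - h (i, ũ_k))`, and
the time average of these means is half the derivative of `C`.

The excursions overlap. Marking `Z k` with `Y k` gives a Markov chain again, and the weighted errors
of the excursions to `w`, rearranged by time step, form a martingale transform whose weight at time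
`n` is the total weight of the excursions unfinished at `n`. That weight is bounded by a multiple of
the time since the last visit to `w`, which has exponential moments by a Lyapunov function, and so
the averages of the errors vanish.
-/

open scoped Matrix

section Stochastic

variable {E : Type*} [Fintype E]

/-- `ϖ` is a stationary distribution of the transition matrix `P`. -/
def IsStationaryDistribution (P : Matrix E E ℝ) (ϖ : E → ℝ) : Prop :=
  ϖ ∈ stdSimplex ℝ E ∧ ϖ ᵥ* P = ϖ

/-- `h` solves the Poisson equation `h - P h = f - C` of the transition matrix `P`: it is the
relative value function of the cost `f` with average cost `C`. -/
def IsPoissonSolution (P : Matrix E E ℝ) (f : E → ℝ) (C : ℝ) (h : E → ℝ) : Prop :=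
  ∀ z, h z = f z - C + (P *ᵥ h) z

theorem IsStationaryDistribution.dotProduct_mulVec {P : Matrix E E ℝ} {ϖ : E → ℝ}
    (hϖ : IsStationaryDistribution P ϖ) (x : E → ℝ) : ϖ ⬝ᵥ P *ᵥ x = ϖ ⬝ᵥ x := by
  rw [Matrix.dotProduct_mulVec, hϖ.2]

theorem IsStationaryDistribution.dotProduct_const {P : Matrix E E ℝ} {ϖ : E → ℝ}
    (hϖ : IsStationaryDistribution P ϖ) (C : ℝ) : (ϖ ⬝ᵥ fun _ => C) = C := by
  simp only [dotProduct, ← Finset.sum_mul, hϖ.1.2, one_mul]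

/-- The performance difference formula: the average cost under `P'` is expressed through a
relative value function for `P`. -/
theorem IsPoissonSolution.dotProduct_eq {P P' : Matrix E E ℝ} {f h ϖ' : E → ℝ} {C : ℝ}
    (hh : IsPoissonSolution P f C h) (hϖ' : IsStationaryDistribution P' ϖ') :
    ϖ' ⬝ᵥ f = C + ϖ' ⬝ᵥ (P' - P) *ᵥ h := by
  have hf : f = (fun _ => C) + (h - P *ᵥ h) := by
    ext z
    simp only [Pi.add_apply, Pi.sub_apply]
    linarith [hh z]
  rw [Matrix.sub_mulVec, dotProduct_sub, hϖ'.dotProduct_mulVec, hf, dotProduct_add, dotProduct_sub,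
    hϖ'.dotProduct_const]

theorem exists_pos_apply_of_isIrreducible {n R : Type*} [Ring R] [LinearOrder R]
    {A : Matrix n n R} (hA : A.IsIrreducible) (j : n) : ∃ i, 0 < A i j := by
  let : Quiver n := A.toQuiver
  obtain ⟨p, hp⟩ := hA.connected j j
  obtain ⟨i, -, e, -⟩ := (Quiver.Path.length_ne_zero_iff_eq_cons p).1 hp.ne'
  exact ⟨i, e.down⟩

variable [DecidableEq E] {P : Matrix E E ℝ}

theorem mulVec_const_of_mem_rowStochastic (hs : P ∈ Matrix.rowStochastic ℝ E) (C : ℝ) :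
    (P *ᵥ fun _ => C) = fun _ => C := by
  ext z
  simp only [Matrix.mulVec, dotProduct, ← Finset.sum_mul,
    Matrix.sum_row_of_mem_rowStochastic hs, one_mul]

theorem mulVec_mono_of_mem_rowStochastic (hs : P ∈ Matrix.rowStochastic ℝ E) :
    Monotone fun x : E → ℝ => P *ᵥ x := fun _ _ hxy _ =>
  Finset.sum_le_sum fun w _ =>
    mul_le_mul_of_nonneg_left (hxy w) (Matrix.nonneg_of_mem_rowStochastic hs)

theorem le_pow_mulVec (hs : P ∈ Matrix.rowStochastic ℝ E) {x : E → ℝ} (hx : x ≤ P *ᵥ x) (k : ℕ) :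
    x ≤ P ^ k *ᵥ x := by
  induction k with
  | zero => simp
  | succ k ih =>
    rw [pow_succ, ← Matrix.mulVec_mulVec]
    exact ih.trans (mulVec_mono_of_mem_rowStochastic (pow_mem hs k) hx)

theorem eq_of_le_mulVec (hP : P.IsIrreducible) (hs : P ∈ Matrix.rowStochastic ℝ E) {x : E → ℝ}
    (hx : x ≤ P *ᵥ x) (z w : E) : x z = x w := by
  have : Nonempty E := ⟨z⟩
  obtain ⟨u, hu⟩ := Finite.exists_max x
  suffices h : ∀ v, x v = x u by rw [h z, h w]
  intro v
  obtain ⟨k, -, hk⟩ := (Matrix.isIrreducible_iff_exists_pow_pos hP.nonneg).1 hP u v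
  have hterm : ∀ v, 0 ≤ (P ^ k) u v * (x u - x v) := fun v =>
    mul_nonneg (Matrix.pow_apply_nonneg hP.nonneg k u v) (sub_nonneg.2 (hu v))
  have hsum : ∑ v, (P ^ k) u v * (x u - x v) ≤ 0 := by
    have hle : x u ≤ ∑ v, (P ^ k) u v * x v := le_pow_mulVec hs hx k u
    simp_rw [mul_sub, Finset.sum_sub_distrib, ← Finset.sum_mul,
      Matrix.sum_row_of_mem_rowStochastic (pow_mem hs k)]
    linarith
  have hzero := (Finset.sum_eq_zero_iff_of_nonneg fun v _ => hterm v).1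
    (hsum.antisymm (Finset.sum_nonneg fun v _ => hterm v)) v (Finset.mem_univ v)
  linarith [(mul_eq_zero.1 hzero).resolve_left hk.ne']

/-- The absolute value of a left eigenvector with eigenvalue `1` is again one: it is a
subsolution whose total mass `P` preserves. -/
theorem exists_isStationaryDistribution [Nonempty E] (hs : P ∈ Matrix.rowStochastic ℝ E) :
    ∃ ϖ, IsStationaryDistribution P ϖ := by
  have hdet : (1 - P).det = 0 := by
    refine Matrix.exists_mulVec_eq_zero_iff.1 ⟨1, one_ne_zero, ?_⟩
    rw [Matrix.sub_mulVec, Matrix.one_mulVec, Matrix.one_vecMul_of_mem_rowStochastic hs, sub_self]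
  obtain ⟨v, hv0, hv⟩ := Matrix.exists_vecMul_eq_zero_iff.2 hdet
  rw [Matrix.vecMul_sub, Matrix.vecMul_one, sub_eq_zero] at hv
  have hle : ∀ w, |v w| ≤ ∑ z, |v z| * P z w := fun w => by
    conv_lhs => rw [hv]
    refine (Finset.abs_sum_le_sum_abs _ _).trans_eq (Finset.sum_congr rfl fun z _ => ?_)
    rw [abs_mul, abs_of_nonneg (Matrix.nonneg_of_mem_rowStochastic hs)]
  have hmass : ∑ w, |v w| = ∑ w, ∑ z, |v z| * P z w := by
    rw [Finset.sum_comm]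
    simp_rw [← Finset.mul_sum, Matrix.sum_row_of_mem_rowStochastic hs, mul_one]
  have heq : ∀ w, |v w| = ∑ z, |v z| * P z w := fun w =>
    (Finset.sum_eq_sum_iff_of_le fun w _ => hle w).1 hmass w (Finset.mem_univ w)
  have hpos : 0 < ∑ w, |v w| := by
    obtain ⟨w, hw⟩ := Function.ne_iff.1 hv0
    exact Finset.sum_pos' (fun w _ => abs_nonneg _) ⟨w, Finset.mem_univ w, abs_pos.2 hw⟩
  refine ⟨fun w => |v w| / ∑ z, |v z|, ⟨fun w => by positivity, ?_⟩, ?_⟩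
  · rw [← Finset.sum_div, div_self hpos.ne']
  · ext w
    rw [heq w, Finset.sum_div]
    exact Finset.sum_congr rfl fun z _ => by ring

/-- The operator `x ↦ x - P x + (ϖ ⬝ᵥ x) 1` is injective by the maximum principle, and on the
preimage of a centred function its last term vanishes. -/
theorem exists_isPoissonSolution (hP : P.IsIrreducible) (hs : P ∈ Matrix.rowStochastic ℝ E)
    {ϖ : E → ℝ} (hϖ : IsStationaryDistribution P ϖ) (f : E → ℝ) :
    ∃ h, IsPoissonSolution P f (ϖ ⬝ᵥ f) h := by
  set L : Matrix E E ℝ := 1 - P + Matrix.replicateRow E ϖ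
  have hL : ∀ x, L *ᵥ x = x - P *ᵥ x + fun _ => ϖ ⬝ᵥ x := fun x => by
    rw [Matrix.add_mulVec, Matrix.sub_mulVec, Matrix.one_mulVec]
    rfl
  have hϖL : ∀ x, ϖ ⬝ᵥ L *ᵥ x = ϖ ⬝ᵥ x := fun x => by
    rw [hL, dotProduct_add, dotProduct_sub, hϖ.dotProduct_mulVec, hϖ.dotProduct_const, sub_self,
      zero_add]
  have hinj : Function.Injective L.mulVec := by
    refine (injective_iff_map_eq_zero L.mulVecLin).2 fun x hx => ?_
    rw [Matrix.mulVecLin_apply] at hx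
    have hϖx : ϖ ⬝ᵥ x = 0 := by rw [← hϖL, hx, dotProduct_zero]
    have hharm : ∀ z, x z = (P *ᵥ x) z := fun z => by
      have := congrFun (hL x) z
      simp only [hx, hϖx, Pi.add_apply, Pi.sub_apply, Pi.zero_apply] at this
      linarith
    have hconst := eq_of_le_mulVec hP hs (fun z => (hharm z).le)
    ext z
    rw [← hϖ.dotProduct_const (x z), funext fun w => hconst z w, hϖx, Pi.zero_apply]
  obtain ⟨h, hh⟩ := Matrix.mulVec_surjective_iff_isUnit.2
    (Matrix.mulVec_injective_iff_isUnit.1 hinj) (f - fun _ => ϖ ⬝ᵥ f)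
  have hϖh : ϖ ⬝ᵥ h = 0 := by
    rw [← hϖL, hh, dotProduct_sub, hϖ.dotProduct_const, sub_self]
  refine ⟨h, fun z => ?_⟩
  have := congrFun (hL h) z
  simp only [hh, hϖh, Pi.add_apply, Pi.sub_apply] at this
  linarith

theorem IsStationaryDistribution.eq_of_isIrreducible (hP : P.IsIrreducible)
    (hs : P ∈ Matrix.rowStochastic ℝ E) {ϖ ϖ' : E → ℝ} (hϖ : IsStationaryDistribution P ϖ)
    (hϖ' : IsStationaryDistribution P ϖ') : ϖ' = ϖ := by
  ext z
  obtain ⟨h, hh⟩ := exists_isPoissonSolution hP hs hϖ (Pi.single z 1)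
  simpa using hh.dotProduct_eq hϖ'

end Stochastic

section Perturbation

variable {E X : Type*} [Fintype E] {x : X}
  {P : X → Matrix E E ℝ} {ϖ : X → E → ℝ}

theorem continuousAt_stationary [DecidableEq E] [TopologicalSpace X]
    (hP : (P x).IsIrreducible)
    (hs : P x ∈ Matrix.rowStochastic ℝ E) (hϖ : ∀ᶠ y in 𝓝 x, IsStationaryDistribution (P y) (ϖ y))
    (hcont : ContinuousAt P x) : ContinuousAt ϖ x := by
  refine continuousAt_pi.2 fun z => ?_
  obtain ⟨h, hh⟩ := exists_isPoissonSolution hP hs hϖ.self_of_nhds (Pi.single z 1)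
  have hbdd : ∀ w, IsBoundedUnder (· ≤ ·) (𝓝 x) fun y => ‖ϖ y w‖ := fun w => by
    refine isBoundedUnder_of_eventually_le (a := 1) (hϖ.mono fun y hy => ?_)
    rw [Real.norm_of_nonneg (hy.1.1 w)]
    exact (Finset.single_le_sum (fun v _ => hy.1.1 v) (Finset.mem_univ w)).trans_eq hy.1.2
  have hdiff : Tendsto (fun y => (P y - P x) *ᵥ h) (𝓝 x) (𝓝 0) := by
    have : ContinuousAt (fun y => (P y - P x) *ᵥ h) x :=
      (by fun_prop : Continuous fun A : Matrix E E ℝ => (A - P x) *ᵥ h).continuousAt.comp hcont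
    simpa [ContinuousAt] using this
  have hterm : Tendsto (fun y => ϖ y ⬝ᵥ (P y - P x) *ᵥ h) (𝓝 x) (𝓝 0) := by
    rw [← Finset.sum_const_zero (ι := E) (s := Finset.univ)]
    exact tendsto_finsetSum _ fun w _ =>
      isBoundedUnder_le_mul_tendsto_zero (hbdd w) (tendsto_pi_nhds.1 hdiff w)
  have hlim := hterm.const_add (ϖ x ⬝ᵥ Pi.single z 1)
  rw [add_zero, dotProduct_single_one] at hlim
  refine hlim.congr' (hϖ.mono fun y hy => ?_)
  simpa using (hh.dotProduct_eq hy).symm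

variable [NormedAddCommGroup X] [NormedSpace ℝ X]

theorem hasFDerivAt_mul_of_eq_zero {a φ : X → ℝ} {φ' : X →L[ℝ] ℝ} (ha : ContinuousAt a x)
    (hφ : HasFDerivAt φ φ' x) (h0 : φ x = 0) :
    HasFDerivAt (fun y => a y * φ y) (a x • φ') x := by
  have hsmall : HasFDerivAt (fun y => (a y - a x) * φ y) (0 : X →L[ℝ] ℝ) x := by
    refine HasFDerivAt.of_isLittleO ?_
    have hone : (fun y => a y - a x) =o[𝓝 x] fun _ => (1 : ℝ) :=
      (Asymptotics.isLittleO_one_iff ℝ).2 (by simpa [ContinuousAt] using ha.sub_const (a x))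
    simpa [h0] using (hone.mul_isBigO hφ.isBigO_sub.norm_right).norm_right
  simpa [sub_mul] using hsmall.fun_add (hφ.const_mul (a x))

theorem IsPoissonSolution.hasFDerivAt_dotProduct {f h : E → ℝ} {C : ℝ}
    {P' : E → E → X →L[ℝ] ℝ} (hh : IsPoissonSolution (P x) f C h) (hcont : ContinuousAt ϖ x)
    (hϖ : ∀ᶠ y in 𝓝 x, IsStationaryDistribution (P y) (ϖ y))
    (hP' : ∀ z w, HasFDerivAt (fun y => P y z w) (P' z w) x) :
    HasFDerivAt (fun y => ϖ y ⬝ᵥ f) (∑ z, ϖ x z • ∑ w, h w • P' z w) x := by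
  have hφ : ∀ z, HasFDerivAt (fun y => ((P y - P x) *ᵥ h) z) (∑ w, h w • P' z w) x := fun z =>
    HasFDerivAt.fun_sum fun w _ => ((hP' z w).sub_const (P x z w)).mul_const (h w)
  have hsum : HasFDerivAt (fun y => C + ϖ y ⬝ᵥ (P y - P x) *ᵥ h)
      (∑ z, ϖ x z • ∑ w, h w • P' z w) x :=
    (HasFDerivAt.fun_sum fun z _ => hasFDerivAt_mul_of_eq_zero (continuousAt_pi.1 hcont z) (hφ z)
      (by simp)).const_add C
  exact hsum.congr_of_eventuallyEq (hϖ.mono fun y hy => hh.dotProduct_eq hy)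

end Perturbation

section Hitting

variable {E : Type*} [Fintype E] [DecidableEq E] {P : Matrix E E ℝ}

/-- `u z` is the expected cost `f` which the chain with transition matrix `P` started from `z`
accumulates at the times `1, …, ν`, where `ν` is the first positive time at which it is at `w`. -/
def IsHittingCost (P : Matrix E E ℝ) (w : E) (f u : E → ℝ) : Prop :=
  u = P *ᵥ (f + Function.update u w 0)

theorem IsPoissonSolution.isHittingCost (hs : P ∈ Matrix.rowStochastic ℝ E) {f h : E → ℝ} {C : ℝ}
    (hh : IsPoissonSolution P f C h) (w : E) :
    IsHittingCost P w (fun z => f z - C) fun z => f w - f z + (h z - h w) := by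
  have hw : Function.update (fun z => f w - f z + (h z - h w)) w 0
      = fun z => f w - f z + (h z - h w) := by
    rw [Function.update_eq_self_iff]
    ring
  have hsum : ((fun z => f z - C) + fun z => f w - f z + (h z - h w))
      = h + fun _ => f w - C - h w := by
    ext z
    simp only [Pi.add_apply]
    ring
  ext z
  rw [hw, hsum, Matrix.mulVec_add, mulVec_const_of_mem_rowStochastic hs, Pi.add_apply]
  linarith [hh z]

/-- The function `|x|` is subharmonic, hence constant, and the mass lost at `w` forces the constant
to be `0`. -/
theorem eq_zero_of_eq_mulVec_update (hP : P.IsIrreducible) (hs : P ∈ Matrix.rowStochastic ℝ E)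
    {w : E} {x : E → ℝ} (hx : x = P *ᵥ Function.update x w 0) : x = 0 := by
  have habs : |x| ≤ P *ᵥ Function.update (|x|) w 0 := fun z => by
    rw [Pi.abs_apply]
    conv_lhs => rw [hx]
    refine (Finset.abs_sum_le_sum_abs _ _).trans_eq (Finset.sum_congr rfl fun v _ => ?_)
    rw [abs_mul, abs_of_nonneg (hP.nonneg z v), Function.update_apply, Function.update_apply]
    split_ifs <;> simp
  have hconst := eq_of_le_mulVec hP hs (habs.trans (mulVec_mono_of_mem_rowStochastic hs
    (update_le_self_iff.2 (abs_nonneg _))))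
  obtain ⟨z, hz⟩ := exists_pos_apply_of_isIrreducible hP w
  have hkilled : Function.update (|x|) w 0 = (fun _ => |x z|) - Pi.single w (|x z|) := by
    ext v
    by_cases hv : v = w
    · subst hv; simp
    · simpa [hv] using hconst v z
  have hloss : |x z| ≤ |x z| - P z w * |x z| := by
    have := habs z
    rw [hkilled, Matrix.mulVec_sub, mulVec_const_of_mem_rowStochastic hs] at this
    simpa [mul_comm] using this
  have hzero : |x z| = 0 := by nlinarith [abs_nonneg (x z)]
  ext v
  exact abs_eq_zero.1 ((hconst v z).trans hzero)

theorem exists_isHittingCost (hP : P.IsIrreducible) (hs : P ∈ Matrix.rowStochastic ℝ E) (w : E)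
    (f : E → ℝ) : ∃ u, IsHittingCost P w f u := by
  set D : Matrix E E ℝ := Matrix.diagonal (Function.update 1 w 0)
  have hD : ∀ x, (1 - P * D) *ᵥ x = x - P *ᵥ Function.update x w 0 := fun x => by
    have : D *ᵥ x = Function.update x w 0 := by
      ext v
      rw [Matrix.mulVec_diagonal, Function.update_apply, Function.update_apply]
      split_ifs <;> simp
    rw [Matrix.sub_mulVec, Matrix.one_mulVec, ← Matrix.mulVec_mulVec, this]
  have hinj : Function.Injective (1 - P * D).mulVec :=
    (injective_iff_map_eq_zero (1 - P * D).mulVecLin).2 fun x hx => by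
      rw [Matrix.mulVecLin_apply, hD, sub_eq_zero] at hx
      exact eq_zero_of_eq_mulVec_update hP hs hx
  obtain ⟨u, hu⟩ := Matrix.mulVec_surjective_iff_isUnit.2
    (Matrix.mulVec_injective_iff_isUnit.1 hinj) (P *ᵥ f)
  refine ⟨u, ?_⟩
  rw [IsHittingCost, Matrix.mulVec_add, ← hu, hD, sub_add_cancel]

theorem IsHittingCost.one_le (hs : P ∈ Matrix.rowStochastic ℝ E) {w : E} {g : E → ℝ}
    (hg : IsHittingCost P w 1 g) (z : E) : 1 ≤ g z := by
  have hstep : ∀ {c : ℝ}, c ≤ 0 → (∀ v, c ≤ g v) → ∀ z, 1 + c ≤ g z := fun {c} hc hcg z => by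
    have hle : (fun _ => 1 + c) ≤ 1 + Function.update g w 0 :=
      add_le_add_right (le_update_iff.2 ⟨hc, fun v _ => hcg v⟩) 1
    have : (P *ᵥ _) z ≤ (P *ᵥ _) z := mulVec_mono_of_mem_rowStochastic hs hle z
    rwa [mulVec_const_of_mem_rowStochastic hs, ← hg] at this
  have : Nonempty E := ⟨z⟩
  obtain ⟨m, hm⟩ := Finite.exists_min g
  have hm0 : 0 ≤ g m := by
    by_contra! hneg
    linarith [hstep hneg.le hm m]
  linarith [hstep le_rfl (fun v => hm0.trans (hm v)) z]

theorem exists_lyapunov (hP : P.IsIrreducible) (hs : P ∈ Matrix.rowStochastic ℝ E) (w : E) :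
    ∃ (g : E → ℝ) (ρ : ℝ), 0 ≤ ρ ∧ ρ < 1 ∧ (∀ z, 1 ≤ g z) ∧
      ∀ z, (P *ᵥ Function.update g w 0) z ≤ ρ * g z := by
  obtain ⟨g, hg⟩ := exists_isHittingCost hP hs w 1
  have hone := hg.one_le hs
  have : Nonempty E := ⟨w⟩
  obtain ⟨m, hm⟩ := Finite.exists_max g
  have hmpos : 0 < g m := by linarith [hone m]
  refine ⟨g, 1 - 1 / g m, sub_nonneg.2 ((div_le_one hmpos).2 (hone m)),
    by linarith [one_div_pos.2 hmpos], hone, fun z => ?_⟩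
  have hgz : g z = 1 + (P *ᵥ Function.update g w 0) z := by
    conv_lhs => rw [hg]
    rw [Matrix.mulVec_add, Matrix.one_vecMul_of_mem_rowStochastic hs]
    rfl
  have hratio : g z / g m ≤ 1 := (div_le_one hmpos).2 (hm z)
  rw [show (1 - 1 / g m) * g z = g z - g z / g m by ring]
  linarith

end Hitting

section TimeAverage

/-- The time average of the sequence `x` is `L`. -/
def HasTimeAverage (x : ℕ → ℝ) (L : ℝ) : Prop :=
  Tendsto (fun N : ℕ => (∑ n ∈ Finset.range N, x n) / N) atTop (𝓝 L)

theorem HasTimeAverage.add {x y : ℕ → ℝ} {K L : ℝ} (hx : HasTimeAverage x K)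
    (hy : HasTimeAverage y L) : HasTimeAverage (fun n => x n + y n) (K + L) :=
  (Tendsto.add hx hy).congr fun N => by rw [Finset.sum_add_distrib, add_div]

theorem hasTimeAverage_sum {ι : Type*} {s : Finset ι} {x : ι → ℕ → ℝ} {L : ι → ℝ}
    (h : ∀ i ∈ s, HasTimeAverage (x i) (L i)) :
    HasTimeAverage (fun n => ∑ i ∈ s, x i n) (∑ i ∈ s, L i) :=
  (tendsto_finsetSum s h).congr fun N => by rw [← Finset.sum_div, Finset.sum_comm]

theorem hasTimeAverage_const (L : ℝ) : HasTimeAverage (fun _ => L) L := by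
  refine tendsto_const_nhds.congr' ((eventually_gt_atTop 0).mono fun N hN => ?_)
  have : (N : ℝ) ≠ 0 := by positivity
  simp [this]

theorem HasTimeAverage.tendsto_sum_Icc {x : ℕ → ℝ} {L : ℝ} (h : HasTimeAverage x L) :
    Tendsto (fun N : ℕ => 1 / (N : ℝ) * ∑ n ∈ Finset.Icc 1 N, x n) atTop (𝓝 L) := by
  have hshift : Tendsto (fun N : ℕ => (∑ n ∈ Finset.range (N + 1), x n) / (N + 1 : ℕ)) atTop
      (𝓝 L) := h.comp (tendsto_add_atTop_nat 1)
  have hlim := (hshift.mul (tendsto_one_div_atTop_nhds_zero_nat.const_add 1)).sub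
    (tendsto_const_div_atTop_nhds_zero_nat (x 0))
  rw [add_zero, mul_one, sub_zero] at hlim
  refine hlim.congr' ((eventually_gt_atTop 0).mono fun N hN => ?_)
  rw [Finset.range_eq_Ico, Finset.sum_eq_sum_Ico_succ_bot N.succ_pos, zero_add,
    Nat.succ_eq_add_one, Finset.Ico_add_one_right_eq_Icc]
  push_cast
  field_simp
  ring

theorem hasTimeAverage_zero_of_tendsto_squares {x : ℕ → ℝ}
    (hsq : Tendsto (fun m : ℕ => (∑ n ∈ Finset.range (m ^ 2), x n) / (m : ℝ) ^ 2) atTop (𝓝 0))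
    (hgap : Tendsto (fun m : ℕ => (∑ n ∈ Finset.Ico (m ^ 2) ((m + 1) ^ 2), |x n|) / (m : ℝ) ^ 2)
      atTop (𝓝 0)) : HasTimeAverage x 0 := by
  have hsqrt : Tendsto Nat.sqrt atTop atTop :=
    tendsto_atTop_atTop.2 fun b => ⟨b ^ 2, fun n hn => Nat.le_sqrt'.2 hn⟩
  have hbound := (hsq.abs.add hgap).comp hsqrt
  rw [abs_zero, add_zero] at hbound
  refine squeeze_zero_norm' ((eventually_gt_atTop 0).mono fun N hN => ?_) hbound
  set m := N.sqrt
  have hmN : m ^ 2 ≤ N := Nat.sqrt_le' N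
  have hsplit : |∑ n ∈ Finset.range N, x n| ≤ |∑ n ∈ Finset.range (m ^ 2), x n|
      + ∑ n ∈ Finset.Ico (m ^ 2) ((m + 1) ^ 2), |x n| := by
    rw [← Finset.sum_range_add_sum_Ico x hmN]
    refine (abs_add_le _ _).trans (add_le_add_right ((Finset.abs_sum_le_sum_abs _ _).trans ?_) _)
    exact Finset.sum_le_sum_of_subset_of_nonneg
      (Finset.Ico_subset_Ico le_rfl (Nat.lt_succ_sqrt' N).le) fun _ _ _ => abs_nonneg _
  simp only [Function.comp_apply]
  have hmsq : (0 : ℝ) < (m : ℝ) ^ 2 := pow_pos (Nat.cast_pos.2 (Nat.sqrt_pos.2 hN)) 2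
  rw [Real.norm_eq_abs, abs_div, abs_div, Nat.abs_cast, abs_of_pos hmsq, ← add_div]
  exact div_le_div₀ (by positivity) hsplit hmsq (by exact_mod_cast hmN)

end TimeAverage

section OrthogonalLLN

variable {Ω : Type*} [MeasurableSpace Ω] {μ : Measure Ω}

theorem ae_tendsto_zero_of_summable_integral_sq {F : ℕ → Ω → ℝ} (hF : ∀ n, MemLp (F n) 2 μ)
    {u : ℕ → ℝ} (hu : Summable u) (hle : ∀ n, ∫ ω, F n ω ^ 2 ∂μ ≤ u n) :
    ∀ᵐ ω ∂μ, Tendsto (fun n => F n ω) atTop (𝓝 0) := by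
  have hmeas : ∀ n, AEMeasurable (fun ω => ENNReal.ofReal (F n ω ^ 2)) μ := fun n =>
    (hF n).integrable_sq.aemeasurable.ennreal_ofReal
  have hsum : ∫⁻ ω, ∑' n, ENNReal.ofReal (F n ω ^ 2) ∂μ ≠ ⊤ := by
    rw [lintegral_tsum hmeas]
    refine ne_top_of_le_ne_top hu.tsum_ofReal_ne_top (ENNReal.tsum_le_tsum fun n => ?_)
    rw [← ofReal_integral_eq_lintegral_ofReal (hF n).integrable_sq
      (ae_of_all _ fun ω => sq_nonneg _)]
    exact ENNReal.ofReal_le_ofReal (hle n)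
  filter_upwards [ae_lt_top' (AEMeasurable.tsum hmeas) hsum] with ω hω
  have hlim := ENNReal.tendsto_cofinite_zero_of_tsum_ne_top hω.ne
  rw [Nat.cofinite_eq_atTop] at hlim
  have hsq := ((ENNReal.tendsto_toReal ENNReal.zero_ne_top).comp hlim).sqrt
  rw [tendsto_zero_iff_abs_tendsto_zero]
  simpa [Function.comp_def, ENNReal.toReal_ofReal, sq_nonneg, Real.sqrt_sq_eq_abs] using hsq

theorem integral_sq_sum_le_of_orthogonal {X : ℕ → Ω → ℝ} {C : ℝ} (hX : ∀ n, MemLp (X n) 2 μ)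
    (hC : ∀ n, ∫ ω, X n ω ^ 2 ∂μ ≤ C) (ho : ∀ j k, j < k → ∫ ω, X j ω * X k ω ∂μ = 0)
    (s : Finset ℕ) : ∫ ω, (∑ n ∈ s, X n ω) ^ 2 ∂μ ≤ s.card * C := by
  have ho' : ∀ j k, k ≠ j → ∫ ω, X j ω * X k ω ∂μ = 0 := fun j k hjk => by
    rcases lt_or_gt_of_ne hjk with h | h
    · simpa [mul_comm] using ho k j h
    · exact ho j k h
  have hint : ∀ j k, Integrable (fun ω => X j ω * X k ω) μ := fun j k =>
    (hX j).integrable_mul (hX k)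
  calc ∫ ω, (∑ n ∈ s, X n ω) ^ 2 ∂μ = ∑ j ∈ s, ∑ k ∈ s, ∫ ω, X j ω * X k ω ∂μ := by
        simp_rw [sq, Finset.sum_mul_sum]
        rw [integral_finsetSum _ fun j _ => integrable_finsetSum _ fun k _ => hint j k]
        exact Finset.sum_congr rfl fun j _ => integral_finsetSum _ fun k _ => hint j k
    _ = ∑ j ∈ s, ∫ ω, X j ω ^ 2 ∂μ := Finset.sum_congr rfl fun j hj => by
        rw [Finset.sum_eq_single_of_mem j hj fun k _ hk => ho' j k hk]
        simp_rw [sq]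
    _ ≤ s.card * C := by
        rw [← nsmul_eq_mul]
        exact Finset.sum_le_card_nsmul _ _ _ fun j _ => hC j

theorem integral_sq_sum_abs_le {X : ℕ → Ω → ℝ} {C : ℝ} (hX : ∀ n, MemLp (X n) 2 μ)
    (hC : ∀ n, ∫ ω, X n ω ^ 2 ∂μ ≤ C) (s : Finset ℕ) :
    ∫ ω, (∑ n ∈ s, |X n ω|) ^ 2 ∂μ ≤ (s.card : ℝ) ^ 2 * C :=
  calc ∫ ω, (∑ n ∈ s, |X n ω|) ^ 2 ∂μ ≤ ∫ ω, s.card * ∑ n ∈ s, X n ω ^ 2 ∂μ :=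
        integral_mono (memLp_finsetSum _ fun n _ => (hX n).abs).integrable_sq
          ((integrable_finsetSum _ fun n _ => (hX n).integrable_sq).const_mul _) fun ω => by
            simpa only [sq_abs] using sq_sum_le_card_mul_sum_sq (s := s) (f := fun n => |X n ω|)
    _ = s.card * ∑ n ∈ s, ∫ ω, X n ω ^ 2 ∂μ := by
        rw [integral_const_mul, integral_finsetSum _ fun n _ => (hX n).integrable_sq]
    _ ≤ s.card * (s.card * C) := by
        rw [← nsmul_eq_mul s.card C]
        gcongr
        exact Finset.sum_le_card_nsmul _ _ _ fun n _ => hC n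
    _ = (s.card : ℝ) ^ 2 * C := by ring

/-- The sums over `[0, m²)` divided by `m²`, and the sums of absolute values over the gaps
`[m², (m + 1)²)` divided by `m²`, have second moments `O(m⁻²)`, which are summable. -/
theorem ae_hasTimeAverage_zero_of_orthogonal {X : ℕ → Ω → ℝ} {C : ℝ} (hX : ∀ n, MemLp (X n) 2 μ)
    (hC : ∀ n, ∫ ω, X n ω ^ 2 ∂μ ≤ C) (ho : ∀ j k, j < k → ∫ ω, X j ω * X k ω ∂μ = 0) :
    ∀ᵐ ω ∂μ, HasTimeAverage (fun n => X n ω) 0 := by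
  have hC0 : 0 ≤ C := (integral_nonneg fun ω => sq_nonneg (X 0 ω)).trans (hC 0)
  have hsummable : Summable fun m : ℕ => 9 * C * (1 / (m : ℝ) ^ 2) :=
    (Real.summable_one_div_nat_pow.2 one_lt_two).mul_left _
  have hscale : ∀ (m : ℕ) (G : Ω → ℝ), ∫ ω, G ω ^ 2 ∂μ ≤ (2 * m + 1) ^ 2 * C →
      ∫ ω, (G ω / (m : ℝ) ^ 2) ^ 2 ∂μ ≤ 9 * C * (1 / (m : ℝ) ^ 2) := fun m G hG => by
    rcases m.eq_zero_or_pos with rfl | hm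
    · simp
    have hm1 : (1 : ℝ) ≤ m := by exact_mod_cast hm
    simp_rw [div_pow, integral_div]
    rw [mul_one_div, div_le_div_iff₀ (by positivity) (by positivity)]
    have hsq : (2 * m + 1 : ℝ) ^ 2 ≤ 9 * m ^ 2 := by nlinarith
    nlinarith [hG.trans (mul_le_mul_of_nonneg_right hsq hC0), sq_nonneg (m : ℝ)]
  have hsquares : ∀ᵐ ω ∂μ, Tendsto
      (fun m : ℕ => (∑ n ∈ Finset.range (m ^ 2), X n ω) / (m : ℝ) ^ 2) atTop (𝓝 0) := by
    refine ae_tendsto_zero_of_summable_integral_sq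
      (fun m => (memLp_finsetSum _ fun n _ => hX n).mul_const _) hsummable
      fun m => hscale m _ ((integral_sq_sum_le_of_orthogonal hX hC ho _).trans ?_)
    rw [Finset.card_range]
    push_cast
    gcongr
    linarith [(Nat.cast_nonneg m : (0 : ℝ) ≤ m)]
  have hgaps : ∀ᵐ ω ∂μ, Tendsto
      (fun m : ℕ => (∑ n ∈ Finset.Ico (m ^ 2) ((m + 1) ^ 2), |X n ω|) / (m : ℝ) ^ 2)
      atTop (𝓝 0) :=
    ae_tendsto_zero_of_summable_integral_sq
      (fun m => (memLp_finsetSum _ fun n _ => (hX n).abs).mul_const _) hsummable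
      fun m => hscale m _ ((integral_sq_sum_abs_le hX hC _).trans_eq (by
        rw [Nat.card_Ico, show (m + 1) ^ 2 - m ^ 2 = 2 * m + 1 by grind]
        push_cast
        rfl))
  filter_upwards [hsquares, hgaps] with ω using hasTimeAverage_zero_of_tendsto_squares

end OrthogonalLLN

section MarkovChain

variable {Ω E : Type*} [mΩ : MeasurableSpace Ω] {μ : Measure Ω} [Fintype E]

/-- The process `Z` is adapted to the filtration `ℱ` and is, relative to it, a Markov chain with
transition matrix `P`. -/
structure IsMarkovChain [MeasurableSpace E] (P : Matrix E E ℝ) (ℱ : Filtration ℕ mΩ)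
    (Z : ℕ → Ω → E) (μ : Measure Ω) : Prop where
  measurable_filtration : ∀ n, Measurable[ℱ n] (Z n)
  condExp_succ : ∀ n (f : E → ℝ),
    μ[fun ω => f (Z (n + 1) ω) | ℱ n] =ᵐ[μ] fun ω => (P *ᵥ f) (Z n ω)

theorem hasTimeAverage_telescoping {x : ℕ → ℝ} {K : ℝ} (hx : ∀ n, |x n| ≤ K) :
    HasTimeAverage (fun n => x (n + 1) - x n) 0 := by
  refine squeeze_zero_norm (fun N => ?_) (tendsto_const_div_atTop_nhds_zero_nat (2 * K))
  rw [Finset.sum_range_sub, norm_div, Real.norm_natCast, Real.norm_eq_abs]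
  gcongr
  linarith [abs_sub (x N) (x 0), hx N, hx 0]

namespace IsMarkovChain

variable [MeasurableSpace E] [DiscreteMeasurableSpace E] {P : Matrix E E ℝ}
  {ℱ : Filtration ℕ mΩ} {Z : ℕ → Ω → E}

theorem measurable_comp (hZ : IsMarkovChain P ℱ Z μ) (f : E → ℝ) (n : ℕ) :
    Measurable[ℱ n] fun ω => f (Z n ω) :=
  (Measurable.of_discrete (f := f)).comp (hZ.measurable_filtration n)

theorem integrable_mul_comp (hZ : IsMarkovChain P ℱ Z μ) (f : E → ℝ) (n : ℕ) {G : Ω → ℝ}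
    (hG : Integrable G μ) : Integrable (fun ω => G ω * f (Z n ω)) μ :=
  hG.mul_bdd ((hZ.measurable_comp f n).mono (ℱ.le n) le_rfl).aestronglyMeasurable
    (ae_of_all _ fun ω => norm_le_pi_norm f (Z n ω))

variable [IsProbabilityMeasure μ]

theorem integral_mul_comp_succ (hZ : IsMarkovChain P ℱ Z μ) (f : E → ℝ) (n : ℕ) {G : Ω → ℝ}
    (hGm : Measurable[ℱ n] G) (hG : Integrable G μ) :
    ∫ ω, G ω * f (Z (n + 1) ω) ∂μ = ∫ ω, G ω * (P *ᵥ f) (Z n ω) ∂μ := by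
  have hf : Integrable (fun ω => f (Z (n + 1) ω)) μ := by
    simpa using hZ.integrable_mul_comp f (n + 1) (integrable_const (1 : ℝ))
  rw [← integral_condExp (ℱ.le n)]
  refine integral_congr_ae ((condExp_mul_of_stronglyMeasurable_left hGm.stronglyMeasurable
    (hZ.integrable_mul_comp f (n + 1) hG) hf).trans ?_)
  filter_upwards [hZ.condExp_succ n f] with ω hω
  rw [Pi.mul_apply, hω]

theorem ae_hasTimeAverage_martingale_transform (hZ : IsMarkovChain P ℱ Z μ) (F : E → ℝ)
    {W : ℕ → Ω → ℝ} {C : ℝ} (hWm : ∀ n, Measurable[ℱ n] (W n)) (hW : ∀ n, MemLp (W n) 2 μ)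
    (hC : ∀ n, ∫ ω, W n ω ^ 2 ∂μ ≤ C) :
    ∀ᵐ ω ∂μ, HasTimeAverage
      (fun n => W n ω * (F (Z (n + 1) ω) - (P *ᵥ F) (Z n ω))) 0 := by
  set ξ : ℕ → Ω → ℝ := fun n ω => F (Z (n + 1) ω) - (P *ᵥ F) (Z n ω)
  have hξm : ∀ n, Measurable[ℱ (n + 1)] (ξ n) := fun n =>
    (hZ.measurable_comp F (n + 1)).sub ((hZ.measurable_comp _ n).mono (ℱ.mono n.le_succ) le_rfl)
  set K : ℝ := ‖F‖ + ‖P *ᵥ F‖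
  have hξK : ∀ n ω, ‖ξ n ω‖ ≤ K := fun n ω =>
    (norm_sub_le _ _).trans (add_le_add (norm_le_pi_norm F _) (norm_le_pi_norm _ _))
  have hX : ∀ n, MemLp (fun ω => W n ω * ξ n ω) 2 μ := fun n =>
    (hW n).of_le_mul (c := K) (((hWm n).mono (ℱ.le n) le_rfl).mul
      ((hξm n).mono (ℱ.le _) le_rfl)).aestronglyMeasurable (ae_of_all _ fun ω => by
        rw [norm_mul, mul_comm]
        exact mul_le_mul_of_nonneg_right (hξK n ω) (norm_nonneg _))
  refine ae_hasTimeAverage_zero_of_orthogonal (C := K ^ 2 * C) hX (fun n => ?_)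
    fun j k hjk => ?_
  · calc ∫ ω, (W n ω * ξ n ω) ^ 2 ∂μ ≤ ∫ ω, K ^ 2 * W n ω ^ 2 ∂μ := by
          refine integral_mono (hX n).integrable_sq ((hW n).integrable_sq.const_mul _) fun ω => ?_
          rw [mul_pow, mul_comm, ← sq_abs (ξ n ω)]
          exact mul_le_mul_of_nonneg_right (pow_le_pow_left₀ (abs_nonneg _) (hξK n ω) 2)
            (sq_nonneg _)
      _ ≤ K ^ 2 * C := by
          rw [integral_const_mul]
          exact mul_le_mul_of_nonneg_left (hC n) (sq_nonneg K)
  · have hG : Integrable (fun ω => W j ω * ξ j ω * W k ω) μ := (hX j).integrable_mul (hW k)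
    have hGm : Measurable[ℱ k] fun ω => W j ω * ξ j ω * W k ω :=
      (((hWm j).mono (ℱ.mono hjk.le) le_rfl).mul ((hξm j).mono (ℱ.mono hjk) le_rfl)).mul (hWm k)
    simp_rw [ξ, ← mul_assoc, mul_sub] at hG hGm ⊢
    rw [integral_sub (hZ.integrable_mul_comp F _ hG) (hZ.integrable_mul_comp _ _ hG),
      hZ.integral_mul_comp_succ F k hGm hG, sub_self]

/-- Up to a bounded telescoping term, `f (Z n) - C` is the martingale difference
`h (Z (n + 1)) - (P h) (Z n)`. -/
theorem ae_hasTimeAverage_of_isPoissonSolution (hZ : IsMarkovChain P ℱ Z μ) {f h : E → ℝ} {C : ℝ}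
    (hh : IsPoissonSolution P f C h) : ∀ᵐ ω ∂μ, HasTimeAverage (fun n => f (Z n ω)) C := by
  filter_upwards [hZ.ae_hasTimeAverage_martingale_transform h (W := 1)
    (fun _ => measurable_const) (fun _ => memLp_const 1) (C := 1) fun _ => by simp] with ω hω
  have htele := hasTimeAverage_telescoping (x := fun n => -h (Z n ω)) (K := ‖h‖) fun n => by
    rw [abs_neg]
    exact norm_le_pi_norm h _
  convert (hω.add htele).add (hasTimeAverage_const C) using 2 with n
  · simp only [Pi.one_apply, one_mul]
    linarith [hh (Z n ω)]
  · ring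

end IsMarkovChain

end MarkovChain

section Excursion

variable {E : Type*}

/-- The first positive number of steps after which the path `z`, observed from time `k` on, is
at `w`. -/
noncomputable def returnTime (z : ℕ → E) (w : E) (k : ℕ) : ℕ :=
  sInf {n | 0 < n ∧ z (k + n) = w}

/-- The total of `f` along the excursion of the path `z` from time `k` to its return to `w`, minus
the prediction `u (z k)`. -/
noncomputable def excursionError (z : ℕ → E) (w : E) (f u : E → ℝ) (k : ℕ) : ℝ :=
  ∑ n ∈ Finset.Ioc k (k + returnTime z w k), f (z n) - u (z k)

variable {z : ℕ → E} {w : E}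

theorem returnTime_mem {k : ℕ} (hk : ∃ n, 0 < n ∧ z (k + n) = w) :
    0 < returnTime z w k ∧ z (k + returnTime z w k) = w :=
  Nat.sInf_mem hk

theorem returnTime_of_eq {k : ℕ} (hz : z (k + 1) = w) : returnTime z w k = 1 :=
  (Nat.sInf_le (show 0 < 1 ∧ z (k + 1) = w from ⟨one_pos, hz⟩)).antisymm
    (returnTime_mem ⟨1, one_pos, hz⟩).1

theorem returnTime_of_ne {k : ℕ} (hz : z (k + 1) ≠ w)
    (hk : ∃ n, 0 < n ∧ z (k + 1 + n) = w) : returnTime z w k = returnTime z w (k + 1) + 1 := by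
  have hret := (returnTime_mem hk).2
  have hk' : 0 < returnTime z w (k + 1) + 1 ∧ z (k + (returnTime z w (k + 1) + 1)) = w :=
    ⟨Nat.succ_pos _, by rwa [add_comm (returnTime z w (k + 1)), ← add_assoc]⟩
  refine le_antisymm (Nat.sInf_le hk') ?_
  obtain ⟨hpos, hret⟩ := returnTime_mem ⟨_, hk'⟩
  obtain ⟨m, hm⟩ := Nat.exists_eq_add_one.2 hpos
  rw [hm, add_comm m, ← add_assoc] at hret
  rw [hm]
  refine Nat.succ_le_succ (Nat.sInf_le ⟨Nat.pos_of_ne_zero ?_, hret⟩)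
  rintro rfl
  exact hz hret

theorem abs_excursionError_le [Fintype E] {k : ℕ} (hk : ∃ n, 0 < n ∧ z (k + n) = w)
    (f u : E → ℝ) : |excursionError z w f u k| ≤ (‖f‖ + ‖u‖) * returnTime z w k := by
  have hone : (1 : ℝ) ≤ returnTime z w k := by exact_mod_cast (returnTime_mem hk).1
  have hsum : |∑ n ∈ Finset.Ioc k (k + returnTime z w k), f (z n)|
      ≤ returnTime z w k * ‖f‖ := by
    have := norm_sum_le_of_le (Finset.Ioc k (k + returnTime z w k))
      fun n _ => norm_le_pi_norm f (z n)
    simpa using this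
  have hu : |u (z k)| ≤ ‖u‖ := norm_le_pi_norm u (z k)
  rw [excursionError]
  nlinarith [abs_sub (∑ n ∈ Finset.Ioc k (k + returnTime z w k), f (z n)) (u (z k)),
    norm_nonneg u]

variable [DecidableEq E]

theorem excursionError_eq (hz : ∀ k, ∃ n, 0 < n ∧ z (k + n) = w) (f u : E → ℝ) (k : ℕ) :
    excursionError z w f u k = (f + Function.update u w 0) (z (k + 1)) - u (z k)
      + if z (k + 1) = w then 0 else excursionError z w f u (k + 1) := by
  by_cases hk : z (k + 1) = w
  · simp [excursionError, returnTime_of_eq hk, hk]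
  · rw [excursionError, excursionError, returnTime_of_ne hk (hz (k + 1)),
      add_comm (returnTime z w (k + 1)), ← add_assoc,
      ← Finset.sum_Ioc_consecutive _ k.le_succ (Nat.le_add_right _ _), Nat.succ_eq_add_one,
      Nat.Ioc_succ_singleton, Finset.sum_singleton, if_neg hk, Pi.add_apply,
      Function.update_of_ne hk]
    ring

/-- The number of steps since the last positive time at which the path `z` was at `w`, or since
time `0` if there is none. -/
def age (z : ℕ → E) (w : E) : ℕ → ℕ
  | 0 => 0
  | n + 1 => if z (n + 1) = w then 0 else age z w n + 1

/-- The total weight `q k` of the times `k < n` whose excursion to `w` is not finished at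
time `n`. -/
noncomputable def activeWeight (z : ℕ → E) (w : E) (q : ℕ → ℝ) : ℕ → ℝ
  | 0 => 0
  | n + 1 => if z (n + 1) = w then 0 else activeWeight z w q n + q n

theorem age_le (n : ℕ) : age z w n ≤ n := by
  induction n with
  | zero => exact le_rfl
  | succ n ih =>
    rw [age]
    split_ifs <;> omega

theorem age_add {k j : ℕ} (h : ∀ i < j, z (k + (i + 1)) ≠ w) :
    age z w (k + j) = age z w k + j := by
  induction j with
  | zero => rfl
  | succ j ih =>
    rw [← add_assoc, age, add_assoc k j, if_neg (h j j.lt_succ_self),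
      ih fun i hi => h i (hi.trans j.lt_succ_self), add_assoc]

theorem abs_activeWeight_le {q : ℕ → ℝ} {κ : ℝ} (hq : ∀ n, |q n| ≤ κ) (n : ℕ) :
    |activeWeight z w q n| ≤ κ * age z w n := by
  induction n with
  | zero => simp [activeWeight, age]
  | succ n ih =>
    rw [activeWeight, age]
    split_ifs
    · simp
    · push_cast
      linarith [abs_add_le (activeWeight z w q n) (q n), hq n]

theorem abs_activeWeight_add_le {q : ℕ → ℝ} {κ : ℝ} (hq : ∀ n, |q n| ≤ κ) (n : ℕ) :
    |activeWeight z w q n + q n| ≤ κ * (age z w n + 1) := by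
  linarith [abs_add_le (activeWeight z w q n) (q n), abs_activeWeight_le (z := z) (w := w) hq n,
    hq n]

theorem sum_mul_excursionError (hz : ∀ k, ∃ n, 0 < n ∧ z (k + n) = w) (f u : E → ℝ)
    (q : ℕ → ℝ) (N : ℕ) :
    ∑ k ∈ Finset.range N, q k * excursionError z w f u k
      = ∑ n ∈ Finset.range N, (activeWeight z w q n + q n)
          * ((f + Function.update u w 0) (z (n + 1)) - u (z n))
        + activeWeight z w q N * excursionError z w f u N := by
  induction N with
  | zero => simp [activeWeight]
  | succ N ih =>
    have hstep : (activeWeight z w q N + q N) * excursionError z w f u N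
        = (activeWeight z w q N + q N)
            * ((f + Function.update u w 0) (z (N + 1)) - u (z N))
          + activeWeight z w q (N + 1) * excursionError z w f u (N + 1) := by
      rw [excursionError_eq hz, activeWeight]
      split_ifs <;> ring
    rw [Finset.sum_range_succ, Finset.sum_range_succ, ih]
    linarith

theorem eventually_two_mul_age_lt
    (hage : Tendsto (fun n : ℕ => (age z w n : ℝ) ^ 2 / n) atTop (𝓝 0)) :
    ∀ᶠ n in atTop, 2 * age z w n < n := by
  filter_upwards [hage.eventually_lt_const (show (0 : ℝ) < 1 / 4 by norm_num),
    eventually_gt_atTop 0] with n hn hpos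
  have hpos' : (1 : ℝ) ≤ n := by exact_mod_cast hpos
  rw [div_lt_iff₀ (by positivity)] at hn
  have : (2 * age z w n : ℝ) < n := by nlinarith
  exact_mod_cast this

theorem exists_return (hage : Tendsto (fun n : ℕ => (age z w n : ℝ) ^ 2 / n) atTop (𝓝 0))
    (k : ℕ) : ∃ n, 0 < n ∧ z (k + n) = w := by
  by_contra! h
  obtain ⟨n₀, hn₀⟩ := eventually_atTop.1 (eventually_two_mul_age_lt hage)
  have hlt := hn₀ (k + (n₀ + k)) (by omega)
  rw [age_add fun i _ => h (i + 1) i.succ_pos] at hlt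
  omega

/-- At the last step before the return the age is `age N + returnTime N - 1`. -/
theorem tendsto_age_mul_returnTime
    (hage : Tendsto (fun n : ℕ => (age z w n : ℝ) ^ 2 / n) atTop (𝓝 0)) :
    Tendsto (fun N : ℕ => (age z w N * returnTime z w N : ℝ) / N) atTop (𝓝 0) := by
  have hz := exists_return hage
  set M : ℕ → ℕ := fun N => N + (returnTime z w N - 1)
  have hM : Tendsto M atTop atTop := tendsto_atTop_mono (fun N => Nat.le_add_right N _) tendsto_id
  have hageM : ∀ N, age z w (M N) = age z w N + (returnTime z w N - 1) := fun N =>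
    age_add fun i hi heq => (Nat.notMem_of_lt_sInf (show i + 1 < returnTime z w N by omega))
      ⟨i.succ_pos, heq⟩
  have hbound : Tendsto (fun N => 4 * ((age z w (M N) : ℝ) ^ 2 / M N)) atTop (𝓝 0) := by
    simpa using (hage.comp hM).const_mul 4
  refine squeeze_zero' (Eventually.of_forall fun N => by positivity) ?_ hbound
  filter_upwards [hM.eventually (eventually_two_mul_age_lt hage), eventually_gt_atTop 0]
    with N hlt hN
  have hMN : M N ≤ 2 * N := by
    have := hageM N
    have : M N = N + (returnTime z w N - 1) := rfl
    omega
  have hprod : age z w N * returnTime z w N ≤ 2 * age z w (M N) ^ 2 := by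
    rw [hageM, ← Nat.succ_pred_eq_of_pos (returnTime_mem (hz N)).1, Nat.succ_sub_one]
    nlinarith [Nat.le_self_pow two_ne_zero (age z w N)]
  have hprod' : (age z w N * returnTime z w N : ℝ) ≤ 2 * (age z w (M N) : ℝ) ^ 2 := by
    exact_mod_cast hprod
  have hMN' : (M N : ℝ) ≤ 2 * N := by exact_mod_cast hMN
  have hMpos : (0 : ℝ) < M N := by exact_mod_cast hN.trans_le (Nat.le_add_right N _)
  rw [← mul_div_assoc, div_le_div_iff₀ (by positivity) hMpos]
  nlinarith [sq_nonneg (age z w (M N) : ℝ), (Nat.cast_nonneg N : (0 : ℝ) ≤ N)]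

theorem hasTimeAverage_mul_excursionError [Finite E]
    (hage : Tendsto (fun n : ℕ => (age z w n : ℝ) ^ 2 / n) atTop (𝓝 0)) {f u : E → ℝ}
    {q : ℕ → ℝ} {κ : ℝ} (hq : ∀ n, |q n| ≤ κ)
    (hsum : HasTimeAverage (fun n => (activeWeight z w q n + q n)
      * ((f + Function.update u w 0) (z (n + 1)) - u (z n))) 0) :
    HasTimeAverage (fun k => q k * excursionError z w f u k) 0 := by
  have := Fintype.ofFinite E
  have hz := exists_return hage
  have hrem : Tendsto (fun N : ℕ => activeWeight z w q N * excursionError z w f u N / N)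
      atTop (𝓝 0) := by
    have hbound := (tendsto_age_mul_returnTime hage).const_mul (κ * (‖f‖ + ‖u‖))
    rw [mul_zero] at hbound
    refine squeeze_zero_norm (fun N => ?_) hbound
    rw [norm_div, norm_mul, Real.norm_natCast, ← mul_div_assoc]
    refine div_le_div_of_nonneg_right ?_ (Nat.cast_nonneg N)
    calc |activeWeight z w q N| * |excursionError z w f u N|
        ≤ (κ * age z w N) * ((‖f‖ + ‖u‖) * returnTime z w N) :=
          mul_le_mul (abs_activeWeight_le hq N) (abs_excursionError_le (hz N) f u)
            (abs_nonneg _) ((abs_nonneg _).trans (abs_activeWeight_le hq N))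
      _ = κ * (‖f‖ + ‖u‖) * (age z w N * returnTime z w N) := by ring
  have hlim := Tendsto.add hsum hrem
  rw [add_zero] at hlim
  exact hlim.congr fun N => by rw [sum_mul_excursionError hz, add_div]

end Excursion

theorem le_div_one_sub_of_succ_le {v : ℕ → ℝ} {a θ : ℝ} (ha : 0 ≤ a) (hθ0 : 0 ≤ θ)
    (hθ1 : θ < 1) (h0 : v 0 ≤ a) (hstep : ∀ n, v (n + 1) ≤ a + θ * v n) (n : ℕ) :
    v n ≤ a / (1 - θ) := by
  rw [le_div_iff₀ (sub_pos.2 hθ1)]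
  induction n with
  | zero => nlinarith
  | succ n ih => nlinarith [hstep n]

namespace IsMarkovChain

variable {Ω E : Type*} [mΩ : MeasurableSpace Ω] {μ : Measure Ω} [Fintype E]
  [DecidableEq E] [MeasurableSpace E] [DiscreteMeasurableSpace E] {P : Matrix E E ℝ}
  {ℱ : Filtration ℕ mΩ} {Z : ℕ → Ω → E}

theorem measurable_age (hZ : IsMarkovChain P ℱ Z μ) (w : E) (n : ℕ) :
    Measurable[ℱ n] fun ω => age (fun m => Z m ω) w n := by
  induction n with
  | zero => exact measurable_const
  | succ n ih =>
    exact Measurable.ite (hZ.measurable_filtration (n + 1) (measurableSet_singleton w))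
      measurable_const ((ih.mono (ℱ.mono n.le_succ) le_rfl).add_const 1)

theorem measurable_activeWeight (hZ : IsMarkovChain P ℱ Z μ) (w : E) {q : ℕ → Ω → ℝ}
    (hq : ∀ n, Measurable[ℱ n] (q n)) (n : ℕ) :
    Measurable[ℱ n] fun ω => activeWeight (fun m => Z m ω) w (fun m => q m ω) n := by
  induction n with
  | zero => exact measurable_const
  | succ n ih =>
    exact Measurable.ite (hZ.measurable_filtration (n + 1) (measurableSet_singleton w))
      measurable_const ((ih.add (hq n)).mono (ℱ.mono n.le_succ) le_rfl)

variable [IsProbabilityMeasure μ]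

theorem memLp_comp_age (hZ : IsMarkovChain P ℱ Z μ) (w : E) {φ : ℕ → ℝ} (hφ : Monotone φ)
    (h0 : 0 ≤ φ 0) (n : ℕ) (p : ENNReal) : MemLp (fun ω => φ (age (fun m => Z m ω) w n)) p μ := by
  have hm : Measurable fun ω => φ (age (fun m => Z m ω) w n) :=
    (Measurable.of_discrete (f := φ)).comp ((hZ.measurable_age w n).mono (ℱ.le n) le_rfl)
  refine MemLp.of_bound hm.aestronglyMeasurable (φ n) (ae_of_all _ fun ω => ?_)
  rw [Real.norm_of_nonneg (h0.trans (hφ (Nat.zero_le _)))]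
  exact hφ (age_le n)

theorem integrable_pow_age (hZ : IsMarkovChain P ℱ Z μ) (w : E) {r : ℝ} (hr : 1 ≤ r) (n : ℕ) :
    Integrable (fun ω => r ^ age (fun m => Z m ω) w n) μ :=
  memLp_one_iff_integrable.1
    (hZ.memLp_comp_age w (pow_right_mono₀ hr) (pow_zero r ▸ zero_le_one) n 1)

theorem integral_pow_age_mul_succ_le (hZ : IsMarkovChain P ℱ Z μ) {w : E} {g : E → ℝ} {r ρ : ℝ}
    (hr : 1 ≤ r) (hg : ∀ z, (P *ᵥ Function.update g w 0) z ≤ ρ * g z) (n : ℕ) :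
    ∫ ω, r ^ age (fun m => Z m ω) w (n + 1) * g (Z (n + 1) ω) ∂μ
      ≤ ‖g‖ + r * ρ * ∫ ω, r ^ age (fun m => Z m ω) w n * g (Z n ω) ∂μ := by
  have hint := hZ.integrable_pow_age w hr
  have hgint := fun n => hZ.integrable_mul_comp g n (hint n)
  have hkill := hZ.integrable_mul_comp (Function.update g w 0) (n + 1) (hint n)
  have hm : Measurable[ℱ n] fun ω => r ^ age (fun m => Z m ω) w n :=
    (Measurable.of_discrete (f := fun m : ℕ => r ^ m)).comp (hZ.measurable_age w n)
  calc ∫ ω, r ^ age (fun m => Z m ω) w (n + 1) * g (Z (n + 1) ω) ∂μ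
      ≤ ∫ ω, ‖g‖ + r * (r ^ age (fun m => Z m ω) w n
          * Function.update g w 0 (Z (n + 1) ω)) ∂μ := by
        refine integral_mono (hgint _) ((integrable_const _).add (hkill.const_mul _))
          fun ω => ?_
        have := (le_abs_self _).trans (norm_le_pi_norm g (Z (n + 1) ω))
        by_cases hw : Z (n + 1) ω = w
        · simp_all [age]
        · simp only [age, hw, if_false, Function.update_of_ne hw, pow_succ]
          linarith [norm_nonneg g]
    _ = ‖g‖ + r * ∫ ω, r ^ age (fun m => Z m ω) w n
          * (P *ᵥ Function.update g w 0) (Z n ω) ∂μ := by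
        rw [integral_add (integrable_const _) (hkill.const_mul _), integral_const_mul,
          hZ.integral_mul_comp_succ _ n hm (hint n), integral_const, probReal_univ, one_smul]
    _ ≤ ‖g‖ + r * ∫ ω, ρ * (r ^ age (fun m => Z m ω) w n * g (Z n ω)) ∂μ := by
        gcongr ‖g‖ + r * ?_
        refine integral_mono (hZ.integrable_mul_comp _ n (hint n)) ((hgint n).const_mul ρ)
          fun ω => ?_
        simp only [mul_left_comm ρ]
        exact mul_le_mul_of_nonneg_left (hg _) (by positivity)
    _ = ‖g‖ + r * ρ * ∫ ω, r ^ age (fun m => Z m ω) w n * g (Z n ω) ∂μ := by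
        rw [integral_const_mul, mul_assoc]

/-- If `g` is the Lyapunov function of `exists_lyapunov` and `r ρ < 1`, the expectation of
`r ^ age n * g (Z n)` contracts by the factor `r ρ` up to a bounded restart term. -/
theorem exists_integral_pow_age_le (hZ : IsMarkovChain P ℱ Z μ) (hP : P.IsIrreducible)
    (hs : P ∈ Matrix.rowStochastic ℝ E) (w : E) :
    ∃ r : ℝ, 1 < r ∧ ∃ C, ∀ n, ∫ ω, r ^ age (fun m => Z m ω) w n ∂μ ≤ C := by
  obtain ⟨g, ρ, hρ0, hρ1, hg1, hg⟩ := exists_lyapunov hP hs w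
  set r : ℝ := 2 / (1 + ρ)
  have hr : 1 < r := (one_lt_div (by positivity)).2 (by linarith)
  have hθ : r * ρ < 1 := by
    rw [div_mul_eq_mul_div, div_lt_one (by positivity)]
    linarith
  have hgint := fun n => hZ.integrable_mul_comp g n (hZ.integrable_pow_age w hr.le n)
  have hinit : ∫ ω, r ^ age (fun m => Z m ω) w 0 * g (Z 0 ω) ∂μ ≤ ‖g‖ := by
    refine (integral_mono (hgint 0) (integrable_const ‖g‖) fun ω => ?_).trans_eq (by simp)
    simpa [age] using (le_abs_self _).trans (norm_le_pi_norm g (Z 0 ω))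
  refine ⟨r, hr, ‖g‖ / (1 - r * ρ), fun n => (integral_mono (hZ.integrable_pow_age w hr.le n)
    (hgint n) fun ω => le_mul_of_one_le_right (by positivity) (hg1 _)).trans ?_⟩
  exact le_div_one_sub_of_succ_le
    (v := fun n => ∫ ω, r ^ age (fun m => Z m ω) w n * g (Z n ω) ∂μ) (norm_nonneg g) (by positivity)
    hθ hinit (hZ.integral_pow_age_mul_succ_le hr.le hg) n

theorem exists_integral_age_pow_le (hZ : IsMarkovChain P ℱ Z μ) (hP : P.IsIrreducible)
    (hs : P ∈ Matrix.rowStochastic ℝ E) (w : E) (k : ℕ) :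
    ∃ C, ∀ n, ∫ ω, (age (fun m => Z m ω) w n : ℝ) ^ k ∂μ ≤ C := by
  obtain ⟨r, hr, C, hC⟩ := hZ.exists_integral_pow_age_le hP hs w
  obtain ⟨B, hB⟩ := (tendsto_pow_const_div_const_pow_of_one_lt k hr).bddAbove_range
  have hle : ∀ m : ℕ, (m : ℝ) ^ k ≤ B * r ^ m := fun m =>
    (div_le_iff₀ (by positivity)).1 (hB ⟨m, rfl⟩)
  have hB0 : 0 ≤ B := (by positivity : (0 : ℝ) ≤ (0 : ℕ) ^ k / r ^ 0).trans (hB ⟨0, rfl⟩)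
  refine ⟨B * C, fun n => ?_⟩
  refine (integral_mono_of_nonneg (ae_of_all _ fun ω => by positivity)
    ((hZ.integrable_pow_age w hr.le n).const_mul B) (ae_of_all _ fun ω => hle _)).trans ?_
  rw [integral_const_mul]
  exact mul_le_mul_of_nonneg_left (hC n) hB0

theorem ae_tendsto_sq_age_div (hZ : IsMarkovChain P ℱ Z μ) (hP : P.IsIrreducible)
    (hs : P ∈ Matrix.rowStochastic ℝ E) (w : E) :
    ∀ᵐ ω ∂μ, Tendsto (fun n : ℕ => (age (fun m => Z m ω) w n : ℝ) ^ 2 / n) atTop (𝓝 0) := by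
  obtain ⟨C, hC⟩ := hZ.exists_integral_age_pow_le hP hs w 4
  refine ae_tendsto_zero_of_summable_integral_sq (u := fun n => C * (1 / (n : ℝ) ^ 2))
    (fun n => ?_) ((Real.summable_one_div_nat_pow.2 one_lt_two).mul_left C) fun n => ?_
  · exact hZ.memLp_comp_age w (φ := fun m => (m : ℝ) ^ 2 / n)
      (fun a b hab => by dsimp only; gcongr) (by positivity) n 2
  · simp_rw [div_pow, ← pow_mul, integral_div]
    rw [mul_one_div]
    exact div_le_div_of_nonneg_right (hC n) (by positivity)

theorem ae_exists_return (hZ : IsMarkovChain P ℱ Z μ) (hP : P.IsIrreducible)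
    (hs : P ∈ Matrix.rowStochastic ℝ E) :
    ∀ᵐ ω ∂μ, ∀ (w : E) (k : ℕ), ∃ n, 0 < n ∧ Z (k + n) ω = w := by
  refine ae_all_iff.2 fun w => ?_
  filter_upwards [hZ.ae_tendsto_sq_age_div hP hs w] with ω hω k using exists_return hω k

section AdaptedWeight

variable {q : ℕ → Ω → ℝ} {κ : ℝ}

theorem memLp_activeWeight_add (hZ : IsMarkovChain P ℱ Z μ) (w : E)
    (hqm : ∀ n, Measurable[ℱ n] (q n)) (hq : ∀ n ω, |q n ω| ≤ κ) (n : ℕ) :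
    MemLp (fun ω => activeWeight (fun m => Z m ω) w (fun m => q m ω) n + q n ω) 2 μ := by
  have hage : MemLp (fun ω => (age (fun m => Z m ω) w n : ℝ) + 1) 2 μ :=
    hZ.memLp_comp_age w (φ := fun m => (m : ℝ) + 1) (fun a b hab => by dsimp only; gcongr)
      (by positivity) n 2
  refine hage.of_le_mul (c := κ) (((hZ.measurable_activeWeight w hqm n).add
    (hqm n)).mono (ℱ.le n) le_rfl).aestronglyMeasurable (ae_of_all _ fun ω => ?_)
  exact (abs_activeWeight_add_le (fun m => hq m ω) n).trans
    (mul_le_mul_of_nonneg_left (le_abs_self _) ((abs_nonneg _).trans (hq n ω)))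

theorem exists_integral_sq_activeWeight_add_le (hZ : IsMarkovChain P ℱ Z μ)
    (hP : P.IsIrreducible) (hs : P ∈ Matrix.rowStochastic ℝ E) (w : E)
    (hqm : ∀ n, Measurable[ℱ n] (q n)) (hq : ∀ n ω, |q n ω| ≤ κ) :
    ∃ C, ∀ n, ∫ ω, (activeWeight (fun m => Z m ω) w (fun m => q m ω) n + q n ω) ^ 2 ∂μ ≤ C := by
  obtain ⟨C, hC⟩ := hZ.exists_integral_age_pow_le hP hs w 2
  have hage : ∀ n, Integrable (fun ω => (age (fun m => Z m ω) w n : ℝ) ^ 2) μ := fun n =>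
    memLp_one_iff_integrable.1 (hZ.memLp_comp_age w (φ := fun m => (m : ℝ) ^ 2)
      (fun a b hab => by dsimp only; gcongr) (by positivity) n 1)
  refine ⟨κ ^ 2 * (2 * C + 2), fun n => ?_⟩
  calc ∫ ω, (activeWeight (fun m => Z m ω) w (fun m => q m ω) n + q n ω) ^ 2 ∂μ
      ≤ ∫ ω, κ ^ 2 * (2 * (age (fun m => Z m ω) w n : ℝ) ^ 2 + 2) ∂μ := by
        refine integral_mono (hZ.memLp_activeWeight_add w hqm hq n).integrable_sq
          ((((hage n).const_mul 2).add (integrable_const _)).const_mul _) fun ω => ?_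
        dsimp only
        rw [← sq_abs]
        refine (pow_le_pow_left₀ (abs_nonneg _)
          (abs_activeWeight_add_le (fun m => hq m ω) n) 2).trans ?_
        rw [mul_pow]
        gcongr
        nlinarith [sq_nonneg ((age (fun m => Z m ω) w n : ℝ) - 1)]
    _ = κ ^ 2 * (2 * ∫ ω, (age (fun m => Z m ω) w n : ℝ) ^ 2 ∂μ + 2) := by
        rw [integral_const_mul, integral_add ((hage n).const_mul 2) (integrable_const _),
          integral_const_mul, integral_const, probReal_univ, one_smul]
    _ ≤ κ ^ 2 * (2 * C + 2) := by
        gcongr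
        exact hC n

theorem ae_hasTimeAverage_mul_excursionError_fixed (hZ : IsMarkovChain P ℱ Z μ)
    (hP : P.IsIrreducible) (hs : P ∈ Matrix.rowStochastic ℝ E) {w : E} {f u : E → ℝ}
    (hu : IsHittingCost P w f u) (hqm : ∀ n, Measurable[ℱ n] (q n)) (hq : ∀ n ω, |q n ω| ≤ κ) :
    ∀ᵐ ω ∂μ, HasTimeAverage
      (fun k => q k ω * excursionError (fun n => Z n ω) w f u k) 0 := by
  obtain ⟨C, hC⟩ := hZ.exists_integral_sq_activeWeight_add_le hP hs w hqm hq
  filter_upwards [hZ.ae_hasTimeAverage_martingale_transform (f + Function.update u w 0)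
    (fun n => (hZ.measurable_activeWeight w hqm n).add (hqm n))
    (hZ.memLp_activeWeight_add w hqm hq) hC, hZ.ae_tendsto_sq_age_div hP hs w] with ω hω hage
  refine hasTimeAverage_mul_excursionError hage (fun n => hq n ω) ?_
  rwa [← hu] at hω

theorem ae_hasTimeAverage_mul_excursionError (hZ : IsMarkovChain P ℱ Z μ)
    (hP : P.IsIrreducible) (hs : P ∈ Matrix.rowStochastic ℝ E) {f : E → ℝ} {u : E → E → ℝ}
    (hu : ∀ w, IsHittingCost P w f (u w)) {T : ℕ → Ω → E} (hT : ∀ n, Measurable[ℱ n] (T n))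
    (hqm : ∀ n, Measurable[ℱ n] (q n)) (hq : ∀ n ω, |q n ω| ≤ κ) :
    ∀ᵐ ω ∂μ, HasTimeAverage
      (fun k => q k ω * excursionError (fun n => Z n ω) (T k ω) f (u (T k ω)) k) 0 := by
  have hfixed : ∀ w, ∀ᵐ ω ∂μ, HasTimeAverage (fun k => (if T k ω = w then q k ω else 0)
      * excursionError (fun n => Z n ω) w f (u w) k) 0 := fun w =>
    hZ.ae_hasTimeAverage_mul_excursionError_fixed hP hs (hu w)
      (q := fun k ω => if T k ω = w then q k ω else 0)
      (fun n => Measurable.ite (hT n (measurableSet_singleton w)) (hqm n) measurable_const)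
      (κ := κ) fun n ω => by
        split_ifs
        · exact hq n ω
        · simpa using (abs_nonneg _).trans (hq n ω)
  filter_upwards [ae_all_iff.2 hfixed] with ω hω
  simpa [ite_mul] using hasTimeAverage_sum (s := Finset.univ) fun w _ => hω w

end AdaptedWeight

end IsMarkovChain

section History

variable {Ω E : Type*} [mΩ : MeasurableSpace Ω] {μ : Measure Ω} [MeasurableSpace E]

/-- The filtration generated by the process `X`: the information at time `n` is the path up to
time `n`. -/
def historyFiltration (X : ℕ → Ω → E) (hX : ∀ n, Measurable (X n)) : Filtration ℕ mΩ where
  seq n := MeasurableSpace.comap (fun ω (m : Finset.Iic n) => X m ω) inferInstance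
  mono' n k hnk := by
    have hrestrict : Measurable fun (x : Finset.Iic k → E) (m : Finset.Iic n) =>
        x ⟨m, Finset.Iic_subset_Iic.2 hnk m.2⟩ := by fun_prop
    rintro _ ⟨B, hB, rfl⟩
    exact ⟨_, hrestrict hB, rfl⟩
  le' n := Measurable.comap_le (measurable_pi_iff.2 fun m : Finset.Iic n => hX m)

variable {X : ℕ → Ω → E}

theorem measurable_historyFiltration (hX : ∀ n, Measurable (X n)) (n : ℕ) :
    Measurable[historyFiltration X hX n] (X n) :=
  (measurable_pi_apply (⟨n, Finset.mem_Iic.2 le_rfl⟩ : Finset.Iic n)).comp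
    (comap_measurable fun ω (m : Finset.Iic n) => X m ω)

variable [DiscreteMeasurableSpace E]

theorem measurableSet_cylinder (hX : ∀ n, Measurable (X n)) (n : ℕ) (x : ℕ → E) :
    MeasurableSet {ω | ∀ m ≤ n, X m ω = x m} := by
  simp only [Set.ofPred_forall]
  exact .iInter fun m => .iInter fun _ => hX m (measurableSet_singleton _)

theorem measureReal_cylinder_of_iIndepFun {φ : E → ℝ} (hind : iIndepFun X μ)
    (hlaw : ∀ n w, μ.real {ω | X n ω = w} = φ w) (n : ℕ) (x : ℕ → E) :
    μ.real {ω | ∀ m ≤ n, X m ω = x m} = ∏ m ∈ Finset.range (n + 1), φ (x m) := by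
  have hinter : {ω | ∀ m ≤ n, X m ω = x m} = ⋂ m ∈ Finset.range (n + 1), X m ⁻¹' {x m} := by
    ext ω
    simp
  rw [hinter, measureReal_def, hind.measure_inter_preimage_eq_mul _
    fun m _ => measurableSet_singleton (x m), ENNReal.toReal_prod]
  exact Finset.prod_congr rfl fun m _ => hlaw m (x m)

theorem setIntegral_eq_of_forall_cylinder [Finite E] (hX : ∀ n, Measurable (X n)) {n : ℕ}
    {F G : Ω → ℝ} (hF : Integrable F μ) (hG : Integrable G μ)
    (h : ∀ x : ℕ → E, ∫ ω in {ω | ∀ m ≤ n, X m ω = x m}, F ω ∂μ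
      = ∫ ω in {ω | ∀ m ≤ n, X m ω = x m}, G ω ∂μ)
    {s : Set Ω} (hs : MeasurableSet[historyFiltration X hX n] s) :
    ∫ ω in s, F ω ∂μ = ∫ ω in s, G ω ∂μ := by
  classical
  have := Fintype.ofFinite E
  obtain ⟨B, -, rfl⟩ := hs
  have hpath : Measurable fun ω (m : Finset.Iic n) => X m ω := measurable_pi_iff.2 fun m => hX m
  have hunion : (fun ω (m : Finset.Iic n) => X m ω) ⁻¹' B
      = ⋃ b ∈ B.toFinset, (fun ω (m : Finset.Iic n) => X m ω) ⁻¹' {b} := by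
    ext ω
    simp
  have hmeas : ∀ b ∈ B.toFinset,
      MeasurableSet ((fun ω (m : Finset.Iic n) => X m ω) ⁻¹' {b}) :=
    fun b _ => hpath (measurableSet_singleton b)
  have hdisj : Set.PairwiseDisjoint (B.toFinset : Set (Finset.Iic n → E))
      fun b => (fun ω (m : Finset.Iic n) => X m ω) ⁻¹' {b} :=
    fun b _ b' _ hbb' => (Set.disjoint_singleton.2 hbb').preimage _
  rw [hunion, integral_biUnion_finset _ hmeas hdisj fun _ _ => hF.integrableOn,
    integral_biUnion_finset _ hmeas hdisj fun _ _ => hG.integrableOn]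
  refine Finset.sum_congr rfl fun b _ => ?_
  have hcyl : (fun ω (m : Finset.Iic n) => X m ω) ⁻¹' {b}
      = {ω | ∀ m ≤ n, X m ω = b ⟨min m n, Finset.mem_Iic.2 (min_le_right m n)⟩} := by
    ext ω
    rw [Set.mem_preimage, Set.mem_singleton_iff, funext_iff, Subtype.forall]
    exact forall_congr' fun m => by
      simp +contextual [Finset.mem_Iic]
  rw [hcyl, h]

variable [IsFiniteMeasure μ]

theorem integrable_comp_of_finite [Finite E] {Y : Ω → E} (hY : Measurable Y) (f : E → ℝ) :
    Integrable (fun ω => f (Y ω)) μ :=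
  (integrable_map_measure .of_discrete hY.aemeasurable).1 .of_finite

variable [Fintype E]

theorem setIntegral_comp_eq_sum {Y : Ω → E} (hY : Measurable Y) (f : E → ℝ) (s : Set Ω) :
    ∫ ω in s, f (Y ω) ∂μ = ∑ w, μ.real (Y ⁻¹' {w} ∩ s) * f w := by
  rw [← integral_map hY.aemeasurable .of_discrete, integral_fintype .of_finite]
  refine Finset.sum_congr rfl fun w _ => ?_
  rw [map_measureReal_apply hY (measurableSet_singleton w),
    measureReal_restrict_apply (hY (measurableSet_singleton w)), smul_eq_mul]

theorem isMarkovChain_historyFiltration {P : Matrix E E ℝ} (hX : ∀ n, Measurable (X n))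
    (hcyl : ∀ n (x : ℕ → E), μ.real {ω | ∀ m ≤ n + 1, X m ω = x m}
      = μ.real {ω | ∀ m ≤ n, X m ω = x m} * P (x n) (x (n + 1))) :
    IsMarkovChain P (historyFiltration X hX) X μ := by
  classical
  refine ⟨measurable_historyFiltration hX, fun n f => ?_⟩
  have hint := fun (n : ℕ) (f : E → ℝ) => integrable_comp_of_finite (μ := μ) (hX n) f
  refine (ae_eq_condExp_of_forall_setIntegral_eq ((historyFiltration X hX).le n) (hint (n + 1) f)
    (fun s _ _ => (hint n (P *ᵥ f)).integrableOn) (fun s hs _ =>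
      setIntegral_eq_of_forall_cylinder hX (hint n (P *ᵥ f)) (hint (n + 1) f) (fun x => ?_) hs)
    ((Measurable.of_discrete (f := P *ᵥ f)).comp
      (measurable_historyFiltration hX n)).stronglyMeasurable.aestronglyMeasurable).symm
  have hpast : ∫ ω in {ω | ∀ m ≤ n, X m ω = x m}, (P *ᵥ f) (X n ω) ∂μ
      = μ.real {ω | ∀ m ≤ n, X m ω = x m} * (P *ᵥ f) (x n) := by
    rw [setIntegral_congr_fun (g := fun _ => (P *ᵥ f) (x n)) (measurableSet_cylinder hX n x)
      fun ω hω => congrArg _ (hω n le_rfl), setIntegral_const, smul_eq_mul]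
  have hextend : ∀ w, X (n + 1) ⁻¹' {w} ∩ {ω | ∀ m ≤ n, X m ω = x m}
      = {ω | ∀ m ≤ n + 1, X m ω = Function.update x (n + 1) w m} := fun w => by
    ext ω
    simp only [Set.mem_inter_iff, Set.mem_preimage, Set.mem_singleton_iff, Set.mem_ofPred_eq,
      Nat.le_succ_iff_eq_or_le, forall_eq_or_imp, Function.update_self]
    refine and_congr_right fun _ => forall₂_congr fun m hm => ?_
    rw [Function.update_of_ne (Nat.lt_succ_of_le hm).ne]
  have hpast' : ∀ w, {ω | ∀ m ≤ n, X m ω = Function.update x (n + 1) w m}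
      = {ω | ∀ m ≤ n, X m ω = x m} := fun w => by
    ext ω
    refine forall₂_congr fun m hm => ?_
    rw [Function.update_of_ne (Nat.lt_succ_of_le hm).ne]
  rw [hpast, setIntegral_comp_eq_sum (hX (n + 1)), Matrix.mulVec, dotProduct, Finset.mul_sum]
  refine Finset.sum_congr rfl fun w _ => ?_
  rw [hextend, hcyl, hpast', Function.update_self, Function.update_of_ne n.lt_succ_self.ne,
    mul_assoc]

end History

section Marked

variable {E F : Type*} [Fintype E] [Fintype F] {P : Matrix E E ℝ} {φ : F → ℝ}

/-- The transition matrix of a Markov chain with transition matrix `P` whose states carry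
independent marks of law `φ`. -/
def markedKernel (P : Matrix E E ℝ) (φ : F → ℝ) : Matrix (E × F) (E × F) ℝ :=
  fun x y => P x.1 y.1 * φ y.2

theorem markedKernel_mulVec (P : Matrix E E ℝ) (φ : F → ℝ) (g : E × F → ℝ) (x : E × F) :
    (markedKernel P φ *ᵥ g) x = (P *ᵥ fun w => ∑ b, φ b * g (w, b)) x.1 := by
  simp only [Matrix.mulVec, dotProduct, markedKernel, Fintype.sum_prod_type, Finset.mul_sum,
    mul_assoc]

theorem markedKernel_mulVec_comp_fst (hφ : ∑ b, φ b = 1) (f : E → ℝ) (x : E × F) :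
    (markedKernel P φ *ᵥ fun y => f y.1) x = (P *ᵥ f) x.1 := by
  simp only [markedKernel_mulVec, ← Finset.sum_mul, hφ, one_mul]

theorem IsPoissonSolution.markedKernel (hφ : ∑ b, φ b = 1) {g : E × F → ℝ} {C : ℝ} {H : E → ℝ}
    (hH : IsPoissonSolution P (fun z => ∑ b, φ b * g (z, b)) C H) :
    IsPoissonSolution (markedKernel P φ) g C
      fun x => g x - ∑ b, φ b * g (x.1, b) + H x.1 := fun x => by
  have hmean : (fun w => ∑ b, φ b * (g (w, b) - ∑ b', φ b' * g (w, b') + H w)) = H := by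
    ext w
    simp only [mul_add, mul_sub, Finset.sum_add_distrib, Finset.sum_sub_distrib,
      ← Finset.sum_mul, hφ]
    ring
  rw [markedKernel_mulVec, hmean]
  linarith [hH x.1]

variable {Ω : Type*} [mΩ : MeasurableSpace Ω] {μ : Measure Ω}
  [MeasurableSpace E] [MeasurableSpace F]

theorem IsMarkovChain.fst {ℱ : Filtration ℕ mΩ} {X : ℕ → Ω → E × F}
    (hX : IsMarkovChain (markedKernel P φ) ℱ X μ) (hφ : ∑ b, φ b = 1) :
    IsMarkovChain P ℱ (fun n ω => (X n ω).1) μ where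
  measurable_filtration n := measurable_fst.comp (hX.measurable_filtration n)
  condExp_succ n f := by
    simpa only [markedKernel_mulVec_comp_fst hφ] using hX.condExp_succ n fun x => f x.1

variable [DiscreteMeasurableSpace E] [DiscreteMeasurableSpace F]

variable [IsFiniteMeasure μ]

theorem isMarkovChain_markedKernel {Z : ℕ → Ω → E} {Y : ℕ → Ω → F} (hZ : ∀ n, Measurable (Z n))
    (hY : ∀ n, Measurable (Y n))
    (hcyl : ∀ n (z : ℕ → E), μ.real {ω | ∀ m ≤ n + 1, Z m ω = z m}
      = μ.real {ω | ∀ m ≤ n, Z m ω = z m} * P (z n) (z (n + 1)))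
    (hlaw : ∀ n b, μ.real {ω | Y n ω = b} = φ b) (hYind : iIndepFun Y μ)
    (hYZ : IndepFun (fun ω n => Y n ω) (fun ω n => Z n ω) μ) :
    IsMarkovChain (markedKernel P φ)
      (historyFiltration (fun n ω => (Z n ω, Y n ω)) fun n => (hZ n).prodMk (hY n))
      (fun n ω => (Z n ω, Y n ω)) μ := by
  have hprod : ∀ n (x : ℕ → E × F), μ.real {ω | ∀ m ≤ n, (Z m ω, Y m ω) = x m}
      = (∏ m ∈ Finset.range (n + 1), φ (x m).2) *
        μ.real {ω | ∀ m ≤ n, Z m ω = (x m).1} := fun n x => by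
    have hinter : {ω | ∀ m ≤ n, (Z m ω, Y m ω) = x m}
        = {ω | ∀ m ≤ n, Y m ω = (x m).2} ∩ {ω | ∀ m ≤ n, Z m ω = (x m).1} := by
      ext ω
      simp only [Prod.ext_iff, Set.mem_inter_iff, Set.mem_ofPred_eq, ← forall_and, and_comm]
    have hindep := hYZ.measure_inter_preimage_eq_mul {y | ∀ m ≤ n, y m = (x m).2}
      {z | ∀ m ≤ n, z m = (x m).1}
      (measurableSet_cylinder (X := fun m (y : ℕ → F) => y m) measurable_pi_apply n _)
      (measurableSet_cylinder (X := fun m (z : ℕ → E) => z m) measurable_pi_apply n _)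
    rw [← measureReal_cylinder_of_iIndepFun hYind hlaw, hinter, measureReal_def,
      measureReal_def, measureReal_def, ← ENNReal.toReal_mul]
    exact congrArg _ hindep
  refine isMarkovChain_historyFiltration _ fun n x => ?_
  rw [hprod, hprod, hcyl n fun m => (x m).1, Finset.prod_range_succ _ (n + 1),
    markedKernel]
  ring

end Marked

section PhantomEstimator

variable {E F Ω : Type*} [Fintype E] [Fintype F] [DecidableEq E] [MeasurableSpace E]
  [MeasurableSpace F] [DiscreteMeasurableSpace E] [DiscreteMeasurableSpace F]
  [mΩ : MeasurableSpace Ω] {μ : Measure Ω} [IsProbabilityMeasure μ]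
  {P : Matrix E E ℝ} {φ : F → ℝ} {ϖ : E → ℝ} {ℱ : Filtration ℕ mΩ}

theorem ae_hasTimeAverage_of_isIrreducible {Z : ℕ → Ω → E} (hZ : IsMarkovChain P ℱ Z μ)
    (hP : P.IsIrreducible) (hs : P ∈ Matrix.rowStochastic ℝ E)
    (hϖ : IsStationaryDistribution P ϖ) (f : E → ℝ) :
    ∀ᵐ ω ∂μ, HasTimeAverage (fun n => f (Z n ω)) (ϖ ⬝ᵥ f) := by
  obtain ⟨h, hh⟩ := exists_isPoissonSolution hP hs hϖ f
  exact hZ.ae_hasTimeAverage_of_isPoissonSolution hh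

theorem ae_hasTimeAverage_markedKernel {X : ℕ → Ω → E × F}
    (hX : IsMarkovChain (markedKernel P φ) ℱ X μ) (hφ : ∑ b, φ b = 1) (hP : P.IsIrreducible)
    (hs : P ∈ Matrix.rowStochastic ℝ E) (hϖ : IsStationaryDistribution P ϖ) (g : E × F → ℝ) :
    ∀ᵐ ω ∂μ, HasTimeAverage (fun n => g (X n ω)) (ϖ ⬝ᵥ fun z => ∑ b, φ b * g (z, b)) := by
  obtain ⟨H, hH⟩ := exists_isPoissonSolution hP hs hϖ fun z => ∑ b, φ b * g (z, b)
  exact hX.ae_hasTimeAverage_of_isPoissonSolution (hH.markedKernel hφ)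

theorem ae_hasTimeAverage_mul_excursion {X : ℕ → Ω → E × F}
    (hX : IsMarkovChain (markedKernel P φ) ℱ X μ) (hφ : ∑ b, φ b = 1) (hP : P.IsIrreducible)
    (hs : P ∈ Matrix.rowStochastic ℝ E) (hϖ : IsStationaryDistribution P ϖ) {f : E → ℝ}
    {u : E → E → ℝ} (hu : ∀ w, IsHittingCost P w f (u w)) (q : E × F → ℝ) (T : E × F → E) :
    ∀ᵐ ω ∂μ, HasTimeAverage (fun k => q (X k ω) * ∑ n ∈ Finset.Ioc k
      (k + returnTime (fun n => (X n ω).1) (T (X k ω)) k), f (X n ω).1)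
      (ϖ ⬝ᵥ fun z => ∑ b, φ b * (q (z, b) * u (T (z, b)) z)) := by
  have herror := (hX.fst hφ).ae_hasTimeAverage_mul_excursionError hP hs hu
    (T := fun k ω => T (X k ω)) (fun n => Measurable.of_discrete.comp (hX.measurable_filtration n))
    (hX.measurable_comp q) fun n ω => norm_le_pi_norm q (X n ω)
  filter_upwards [herror, ae_hasTimeAverage_markedKernel hX hφ hP hs hϖ
    fun x => q x * u (T x) x.1] with ω herror hmean
  rw [← zero_add (ϖ ⬝ᵥ _)]
  refine (herror.add hmean).congr fun N => ?_
  simp only [excursionError, ← mul_add, sub_add_cancel]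

/-- The number of steps of the excursion is its cost for `f = 1`, so its weighted time average
converges as well and `C` may be replaced by any estimate `Γ N → C`. -/
theorem ae_tendsto_phantomEstimator {X : ℕ → Ω → E × F}
    (hX : IsMarkovChain (markedKernel P φ) ℱ X μ) (hφ : ∑ b, φ b = 1) (hP : P.IsIrreducible)
    (hs : P ∈ Matrix.rowStochastic ℝ E) (hϖ : IsStationaryDistribution P ϖ) {f h : E → ℝ} {C : ℝ}
    (hh : IsPoissonSolution P f C h) (q : E × F → ℝ) (T : E × F → E) :
    ∀ᵐ ω ∂μ, ∀ Γ : ℕ → ℝ, Tendsto Γ atTop (𝓝 C) →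
      Tendsto (fun N : ℕ => 1 / (N : ℝ) * ∑ k ∈ Finset.Icc 1 N, q (X k ω) *
        (f (X k ω).1 - f (T (X k ω))
          + ∑ n ∈ Finset.Ioc k (k + returnTime (fun n => (X n ω).1) (T (X k ω)) k), f (X n ω).1
          - returnTime (fun n => (X n ω).1) (T (X k ω)) k * Γ N))
        atTop (𝓝 (ϖ ⬝ᵥ fun z => ∑ b, φ b * (q (z, b) * (h z - h (T (z, b)))))) := by
  choose g hg using fun w => exists_isHittingCost hP hs w 1
  filter_upwards [ae_hasTimeAverage_mul_excursion hX hφ hP hs hϖ (hh.isHittingCost hs) q T,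
    ae_hasTimeAverage_markedKernel hX hφ hP hs hϖ fun x => q x * (f x.1 - f (T x)),
    ae_hasTimeAverage_mul_excursion hX hφ hP hs hϖ hg q T] with ω hcost hinit hlength Γ hΓ
  have hcentred := (hcost.add hinit).tendsto_sum_Icc
  have hcorrection := hlength.tendsto_sum_Icc.mul (hΓ.const_sub C)
  have hlim := hcentred.add hcorrection
  rw [sub_self, mul_zero, add_zero, ← dotProduct_add] at hlim
  convert hlim using 2 with N
  · simp only [Pi.one_apply, Finset.sum_const, Nat.card_Ioc, Finset.sum_sub_distrib,
      add_tsub_cancel_left, nsmul_eq_mul, mul_one]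
    rw [mul_assoc, ← mul_add, Finset.sum_mul, ← Finset.sum_add_distrib]
    refine congrArg _ (Finset.sum_congr rfl fun k _ => ?_)
    ring
  · congr 2
    ext z
    rw [Pi.add_apply, ← Finset.sum_add_distrib]
    refine Finset.sum_congr rfl fun b _ => ?_
    ring

end PhantomEstimator

namespace MDP

section Policy

variable {S : Type*} {d : S → ℕ}

theorem mem_interior_angleBox [Finite S] {α : Angles d} :
    α ∈ interior (angleBox d) ↔ ∀ i p, α i p ∈ Set.Ioo 0 (Real.pi / 2) := by
  have hpi : angleBox d =
      Set.univ.pi fun i => Set.univ.pi fun _ : Fin (d i) => Set.Icc 0 (Real.pi / 2) :=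
    Set.ext fun β => by simp only [angleBox, Set.mem_ofPred_eq, Set.mem_univ_pi]
  simp only [hpi, interior_pi_set Set.finite_univ, interior_Icc, Set.mem_univ_pi]

theorem sin_pos_of_mem_interior_angleBox [Finite S] {α : Angles d}
    (hα : α ∈ interior (angleBox d)) (i : S) (p : Fin (d i)) : 0 < Real.sin (α i p) := by
  obtain ⟨h0, hpi⟩ := mem_interior_angleBox.1 hα i p
  exact Real.sin_pos_of_pos_of_lt_pi h0 (by linarith)

theorem cos_pos_of_mem_interior_angleBox [Finite S] {α : Angles d}
    (hα : α ∈ interior (angleBox d)) (i : S) (p : Fin (d i)) : 0 < Real.cos (α i p) := by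
  obtain ⟨h0, hpi⟩ := mem_interior_angleBox.1 hα i p
  exact Real.cos_pos_of_mem_Ioo ⟨by linarith, hpi⟩

theorem policy_nonneg (α : Angles d) (i : S) (a : Fin (d i + 1)) : 0 ≤ policy α i a :=
  sq_nonneg _

theorem policy_castSucc (α : Angles d) (i : S) (p : Fin (d i)) :
    policy α i p.castSucc =
      Real.cos (α i p) ^ 2 * ∏ k ∈ Finset.univ.filter (· < p), Real.sin (α i k) ^ 2 := by
  simp [policy, sphericalCoord, mul_pow, Finset.prod_pow]

theorem prod_Iic_sin_sq {α : Angles d} {i : S} {p : Fin (d i)} (hcos : Real.cos (α i p) ≠ 0) :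
    ∏ m ∈ Finset.Iic p, Real.sin (α i m) ^ 2 = Real.tan (α i p) ^ 2 * policy α i p.castSucc := by
  rw [policy_castSucc, ← mul_assoc, ← mul_pow, Real.tan_mul_cos hcos, Finset.filter_gt_eq_Iio,
    ← Finset.Iio_insert, Finset.prod_insert Finset.notMem_Iio_self]

theorem policy_last (α : Angles d) (i : S) :
    policy α i (Fin.last (d i)) = ∏ k, Real.sin (α i k) ^ 2 := by
  simp [policy, sphericalCoord, Finset.prod_pow]

theorem sum_policy (α : Angles d) (i : S) : ∑ a, policy α i a = 1 := by
  have htelescope := Finset.prod_one_sub_ordered Finset.univ fun k => Real.cos (α i k) ^ 2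
  simp only [← Real.sin_sq] at htelescope
  simp only [Fin.sum_univ_castSucc, policy_castSucc, policy_last, htelescope, add_sub_cancel]

theorem policy_castSucc_pos [Finite S] {α : Angles d} (hα : α ∈ interior (angleBox d)) (i : S)
    (p : Fin (d i)) : 0 < policy α i p.castSucc := by
  rw [policy_castSucc]
  exact mul_pos (pow_pos (cos_pos_of_mem_interior_angleBox hα i p) 2)
    (Finset.prod_pos fun k _ => pow_pos (sin_pos_of_mem_interior_angleBox hα i k) 2)

/-- The factor contributed by the `k`-th angle `x` to the policy of action `a`. -/
noncomputable def angleFactor {n : ℕ} (a : Fin (n + 1)) (k : Fin n) (x : ℝ) : ℝ :=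
  if k.castSucc < a then Real.sin x ^ 2 else if k.castSucc = a then Real.cos x ^ 2 else 1

theorem policy_eq_prod_angleFactor (α : Angles d) (i : S) (a : Fin (d i + 1)) :
    policy α i a = ∏ k, angleFactor a k (α i k) := by
  cases a using Fin.lastCases with
  | last => simp [policy_last, angleFactor, Fin.castSucc_lt_last]
  | cast p =>
    have hfactor : ∀ k, angleFactor p.castSucc k (α i k) =
        (if k = p then Real.cos (α i k) ^ 2 else 1) *
          if k < p then Real.sin (α i k) ^ 2 else 1 := by
      intro k
      rcases lt_trichotomy k p with h | rfl | h <;>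
        simp [angleFactor, *, ne_of_lt, ne_of_gt, not_lt_of_gt]
    simp only [hfactor, Finset.prod_mul_distrib, policy_castSucc, Finset.prod_ite_eq',
      Finset.prod_filter, Finset.mem_univ, if_true]

theorem differentiable_angleFactor {n : ℕ} (a : Fin (n + 1)) (k : Fin n) :
    Differentiable ℝ (angleFactor a k) := by
  unfold angleFactor
  split_ifs <;> fun_prop

theorem differentiable_policy [Finite S] (i : S) (a : Fin (d i + 1)) :
    Differentiable ℝ fun α : Angles d => policy α i a := fun α => by
  have := Fintype.ofFinite S
  have hcoord : ∀ k, DifferentiableAt ℝ (fun β : Angles d => β i k) α := by fun_prop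
  simp only [policy_eq_prod_angleFactor]
  exact (HasFDerivAt.finsetProd fun k _ =>
    ((differentiable_angleFactor a k _).comp α (hcoord k)).hasFDerivAt).differentiableAt

end Policy

section AngleDerivative

variable {S : Type*} [DecidableEq S] {d : S → ℕ}

/-- The direction of the coordinate `α_{ip}` in the space of angles. -/
abbrev angleDirection (i : S) (p : Fin (d i)) : Angles d := Pi.single i (Pi.single p 1)

variable [Finite S] {α : Angles d}

theorem fderiv_policy_angleDirection_of_ne {i j : S} (hij : j ≠ i) (p : Fin (d i))
    (a : Fin (d j + 1)) :
    fderiv ℝ (fun β => policy β j a) α (angleDirection i p) = 0 := by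
  have := Fintype.ofFinite S
  have hline : HasLineDerivAt ℝ (fun β => policy β j a) 0 α (angleDirection i p) := by
    refine (hasDerivAt_const (0 : ℝ) (policy α j a)).congr_of_eventuallyEq ?_
    exact Eventually.of_forall fun t => by
      simp [policy, sphericalCoord, Pi.single_eq_of_ne hij]
  exact ((differentiable_policy j a α).hasFDerivAt.hasLineDerivAt _).unique hline

theorem fderiv_policy_angleDirection_eq_mul {i : S} {p : Fin (d i)} {a : Fin (d i + 1)} {r : ℝ}
    (hr : HasDerivAt (angleFactor a p) (r * angleFactor a p (α i p)) (α i p)) :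
    fderiv ℝ (fun β => policy β i a) α (angleDirection i p) = r * policy α i a := by
  have := Fintype.ofFinite S
  have hsplit : ∀ β, policy β i a
      = angleFactor a p (β i p) * ∏ k ∈ Finset.univ.erase p, angleFactor a k (β i k) := fun β => by
    rw [policy_eq_prod_angleFactor,
      Finset.mul_prod_erase _ (fun k => angleFactor a k (β i k)) (Finset.mem_univ p)]
  have hline : ∀ t : ℝ, policy (α + t • angleDirection i p) i a
      = angleFactor a p (α i p + t) * ∏ k ∈ Finset.univ.erase p, angleFactor a k (α i k) := by
    intro t
    rw [hsplit]
    congr 1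
    · simp
    · exact Finset.prod_congr rfl fun k hk => by
        simp [Pi.single_eq_of_ne (Finset.ne_of_mem_erase hk)]
  have hderiv : HasLineDerivAt ℝ (fun β => policy β i a) (r * policy α i a) α
      (angleDirection i p) := by
    simp only [HasLineDerivAt, hline, hsplit α, ← mul_assoc]
    refine HasDerivAt.mul_const ?_ _
    exact HasDerivAt.comp_const_add (α i p) 0 (by rwa [add_zero])
  exact ((differentiable_policy i a α).hasFDerivAt.hasLineDerivAt _).unique hderiv

theorem fderiv_policy_angleDirection (hα : α ∈ interior (angleBox d)) (i : S) (p : Fin (d i))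
    (a : Fin (d i + 1)) :
    fderiv ℝ (fun β => policy β i a) α (angleDirection i p)
      = -2 * Real.tan (α i p) * policy α i p.castSucc *
        ((if a = p.castSucc then 1 else 0) - phantomLaw α i p a) := by
  have hsin := (sin_pos_of_mem_interior_angleBox hα i p).ne'
  have hcos := (cos_pos_of_mem_interior_angleBox hα i p).ne'
  rcases lt_trichotomy a p.castSucc with ha | rfl | ha
  · have hfactor : angleFactor a p = fun _ => 1 := by
      ext x; simp [angleFactor, ha.ne', ha.not_gt]
    rw [fderiv_policy_angleDirection_eq_mul (r := 0) (by simp [hfactor, hasDerivAt_const])]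
    simp [phantomLaw, ha.ne, (ha.trans p.castSucc_lt_succ).not_ge]
  · have hfactor : angleFactor p.castSucc p = fun x => Real.cos x ^ 2 := by
      ext x; simp [angleFactor]
    rw [fderiv_policy_angleDirection_eq_mul (r := -2 * Real.tan (α i p))]
    · simp [phantomLaw]
    · rw [hfactor, Real.tan_eq_sin_div_cos]
      refine ((Real.hasDerivAt_cos (α i p)).pow 2).congr_deriv ?_
      field_simp
      ring
  · have hfactor : angleFactor a p = fun x => Real.sin x ^ 2 := by
      ext x; simp [angleFactor, ha]
    rw [fderiv_policy_angleDirection_eq_mul (r := 2 * (Real.cos (α i p) / Real.sin (α i p)))]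
    · have hpolicy := (policy_castSucc_pos hα i p).ne'
      rw [phantomLaw, if_pos (Fin.castSucc_lt_iff_succ_le.1 ha), if_neg ha.ne',
        prod_Iic_sin_sq hcos, Real.tan_eq_sin_div_cos]
      field_simp
      ring
    · rw [hfactor]
      refine ((Real.hasDerivAt_sin (α i p)).pow 2).congr_deriv ?_
      field_simp
      ring

theorem sum_mul_fderiv_policy_angleDirection (hα : α ∈ interior (angleBox d)) (i : S)
    (p : Fin (d i)) (g : Fin (d i + 1) → ℝ) :
    ∑ a, g a * fderiv ℝ (fun β => policy β i a) α (angleDirection i p)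
      = -2 * Real.tan (α i p) * policy α i p.castSucc *
        (g p.castSucc - ∑ a, phantomLaw α i p a * g a) := by
  have hsum : ∑ a, ((if a = p.castSucc then 1 else 0) - phantomLaw α i p a) * g a
      = g p.castSucc - ∑ a, phantomLaw α i p a * g a := by
    simp only [sub_mul, Finset.sum_sub_distrib, ite_mul, one_mul, zero_mul, Finset.sum_ite_eq',
      Finset.mem_univ, if_true]
  simp only [fderiv_policy_angleDirection hα, ← hsum, Finset.mul_sum]
  exact Finset.sum_congr rfl fun a _ => by ring

end AngleDerivative

section PhantomLaw

variable {S : Type*} [Finite S] {d : S → ℕ} {α : Angles d}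

/-- Obtained by differentiating `∑ a, θ_{ia} = 1` with respect to `α_{ip}`. -/
theorem sum_phantomLaw (hα : α ∈ interior (angleBox d)) (i : S) (p : Fin (d i)) :
    ∑ a, phantomLaw α i p a = 1 := by
  classical
  have := Fintype.ofFinite S
  have hsum : ∑ a, fderiv ℝ (fun β => policy β i a) α (angleDirection i p) = 0 := by
    rw [← sum_apply, ← fderiv_fun_sum fun a _ => differentiable_policy i a α]
    simp [sum_policy]
  have hweighted := sum_mul_fderiv_policy_angleDirection hα i p 1
  simp only [Pi.one_apply, one_mul, mul_one, hsum] at hweighted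
  have htan := Real.tan_pos_of_pos_of_lt_pi_div_two (mem_interior_angleBox.1 hα i p).1
    (mem_interior_angleBox.1 hα i p).2
  have hpolicy := policy_castSucc_pos hα i p
  exact (sub_eq_zero.1 ((mul_eq_zero.1 hweighted.symm).resolve_left (by positivity))).symm

theorem phantomLaw_eq_single (hα : α ∈ interior (angleBox d)) {i : S} {p : Fin (d i)}
    (hp : ¬ (p : ℕ) + 1 < d i) : phantomLaw α i p = Pi.single p.succ 1 := by
  have hzero : ∀ a, a ≠ p.succ → phantomLaw α i p a = 0 := fun a ha =>
    if_neg fun hle => ha (by simp only [Fin.ext_iff, Fin.le_def, Fin.val_succ] at *; omega)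
  have hone := sum_phantomLaw hα i p
  rw [Finset.sum_eq_single p.succ (fun a _ => hzero a) (by simp)] at hone
  ext a
  by_cases ha : a = p.succ
  · rw [ha, hone, Pi.single_eq_same]
  · rw [hzero a ha, Pi.single_eq_of_ne ha]

theorem policy_succ_of_not_lt (hα : α ∈ interior (angleBox d)) {i : S} {p : Fin (d i)}
    (hp : ¬ (p : ℕ) + 1 < d i) :
    policy α i p.succ = Real.tan (α i p) ^ 2 * policy α i p.castSucc := by
  have hone : phantomLaw α i p p.succ = 1 := by
    rw [phantomLaw_eq_single hα hp, Pi.single_eq_same]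
  rw [phantomLaw, if_pos le_rfl,
    prod_Iic_sin_sq (cos_pos_of_mem_interior_angleBox hα i p).ne'] at hone
  exact eq_of_div_eq_one hone

variable [DecidableEq S]

theorem sum_phantomLaw_mul_weight_of_lt (hα : α ∈ interior (angleBox d)) {i : S} {p : Fin (d i)}
    (hp : (p : ℕ) + 1 < d i) (h : StateAction d → ℝ) (z : StateAction d) :
    ∑ a, phantomLaw α i p a * (weight α i p z * (h z - h ⟨i, phantomAction i p z a⟩))
      = visit i p.castSucc z *
        (-Real.tan (α i p) * (h z - ∑ a, phantomLaw α i p a * h ⟨i, a⟩)) := by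
  simp only [weight, phantomAction, if_pos hp, mul_left_comm (phantomLaw α i p _),
    ← Finset.mul_sum, mul_assoc]
  simp only [mul_sub, Finset.sum_sub_distrib, ← Finset.sum_mul, sum_phantomLaw hα, one_mul]
  ring

theorem sum_phantomLaw_mul_weight_of_not_lt (hα : α ∈ interior (angleBox d)) {i : S}
    {p : Fin (d i)} (hp : ¬ (p : ℕ) + 1 < d i) (h : StateAction d → ℝ) (z : StateAction d) :
    ∑ a, phantomLaw α i p a * (weight α i p z * (h z - h ⟨i, phantomAction i p z a⟩))
      = visit i p.castSucc z *
          (Real.cos (α i p) * Real.sin (α i p) * (h ⟨i, p.succ⟩ - h ⟨i, p.castSucc⟩))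
        + visit i p.succ z *
          (Real.cos (α i p) * Real.sin (α i p) * (h ⟨i, p.succ⟩ - h ⟨i, p.castSucc⟩)) := by
  have hne : p.succ ≠ p.castSucc := (Fin.castSucc_lt_succ).ne'
  rw [phantomLaw_eq_single hα hp, Fintype.sum_eq_single p.succ fun a ha => by simp [ha],
    Pi.single_eq_same, one_mul, weight, if_neg hp]
  by_cases hcast : z = ⟨i, p.castSucc⟩
  · subst hcast
    simp only [visit, phantomAction, if_pos, if_neg hp, hne.symm, Sigma.mk.injEq, heq_eq_eq,
      true_and, Fin.val_castSucc, ite_false]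
    ring
  by_cases hsucc : z = ⟨i, p.succ⟩
  · subst hsucc
    simp [visit, phantomAction, hp, hne]
  · simp [visit, hcast, hsucc]

end PhantomLaw

theorem dotProduct_visit_mul {S : Type*} [Fintype S] [DecidableEq S] {d : S → ℕ} (i : S)
    (a : Fin (d i + 1)) (v g : StateAction d → ℝ) :
    v ⬝ᵥ (fun z => visit i a z * g z) = v ⟨i, a⟩ * g ⟨i, a⟩ := by
  simp [dotProduct, visit]

section Stationary

variable {S : Type*} [Fintype S] {d : S → ℕ} {M : MDP S d} {α : Angles d}

theorem kernel_mem_rowStochastic [DecidableEq S] (M : MDP S d) (α : Angles d) :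
    M.kernel α ∈ Matrix.rowStochastic ℝ (StateAction d) := by
  refine Matrix.mem_rowStochastic_iff_sum.2
    ⟨fun z w => mul_nonneg (policy_nonneg _ _ _) (M.A_nonneg _ _ _), fun z => ?_⟩
  simp only [Fintype.sum_sigma, kernel, ← Finset.sum_mul, sum_policy, one_mul, M.A_sum]

theorem hasFDerivAt_kernel (M : MDP S d) (α : Angles d) (z w : StateAction d) :
    HasFDerivAt (fun β => M.kernel β z w)
      (M.A z.1 z.2 w.1 • fderiv ℝ (fun β => policy β w.1 w.2) α) α :=
  (differentiable_policy w.1 w.2 α).hasFDerivAt.mul_const _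

variable [Nonempty (StateAction d)]

theorem existsUnique_isInvariant (hM : (M.kernel α).IsIrreducible) :
    ∃! ϖ, M.IsInvariant α ϖ := by
  classical
  obtain ⟨ϖ, hϖ⟩ := exists_isStationaryDistribution (M.kernel_mem_rowStochastic α)
  exact ⟨ϖ, hϖ, fun _ => hϖ.eq_of_isIrreducible hM (M.kernel_mem_rowStochastic α)⟩

theorem isStationaryDistribution_statDist (hM : (M.kernel α).IsIrreducible) :
    IsStationaryDistribution (M.kernel α) (M.statDist α) :=
  Classical.epsilon_spec (existsUnique_isInvariant hM).exists

/-- The stationary probability that the next state is `i`. -/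
noncomputable def stateMass (M : MDP S d) (α : Angles d) (i : S) : ℝ :=
  ∑ z : StateAction d, M.statDist α z * M.A z.1 z.2 i

theorem statDist_eq_stateMass_mul_policy (hM : (M.kernel α).IsIrreducible) (i : S)
    (a : Fin (d i + 1)) : M.statDist α ⟨i, a⟩ = M.stateMass α i * policy α i a := by
  rw [← congrFun (isStationaryDistribution_statDist hM).2 ⟨i, a⟩, stateMass, Finset.sum_mul]
  exact Finset.sum_congr rfl fun z _ => by simp only [kernel]; ring

theorem hasFDerivAt_statCost (hM : M.IsErgodic) (hα : α ∈ interior (angleBox d))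
    {c h : StateAction d → ℝ} {C : ℝ} (hh : IsPoissonSolution (M.kernel α) c C h) :
    HasFDerivAt (M.statCost c) (∑ z, M.statDist α z • ∑ w : StateAction d, h w •
      M.A z.1 z.2 w.1 • fderiv ℝ (fun β => policy β w.1 w.2) α) α := by
  classical
  have hϖ : ∀ᶠ β in 𝓝 α, IsStationaryDistribution (M.kernel β) (M.statDist β) :=
    mem_of_superset (isOpen_interior.mem_nhds hα) fun β hβ =>
      isStationaryDistribution_statDist (hM β hβ)
  have hcont : ContinuousAt M.statDist α :=
    continuousAt_stationary (hM α hα) (M.kernel_mem_rowStochastic α) hϖ <|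
      continuousAt_pi.2 fun z => continuousAt_pi.2 fun w =>
        (M.hasFDerivAt_kernel α z w).continuousAt
  exact hh.hasFDerivAt_dotProduct hcont hϖ (hasFDerivAt_kernel M α)

theorem exists_isPoissonSolution_statCost (hM : (M.kernel α).IsIrreducible)
    (c : StateAction d → ℝ) : ∃ h, IsPoissonSolution (M.kernel α) c (M.statCost c α) h := by
  classical
  exact exists_isPoissonSolution hM (M.kernel_mem_rowStochastic α)
    (isStationaryDistribution_statDist hM) c

variable [DecidableEq S]

theorem fderiv_statCost_angleDirection (hM : M.IsErgodic) (hα : α ∈ interior (angleBox d))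
    {c h : StateAction d → ℝ} {C : ℝ} (hh : IsPoissonSolution (M.kernel α) c C h) (i : S)
    (p : Fin (d i)) :
    fderiv ℝ (M.statCost c) α (angleDirection i p)
      = -2 * Real.tan (α i p) * M.statDist α ⟨i, p.castSucc⟩ *
        (h ⟨i, p.castSucc⟩ - ∑ a, phantomLaw α i p a * h ⟨i, a⟩) := by
  have hinner : ∀ z : StateAction d, ∑ w : StateAction d, h w * (M.A z.1 z.2 w.1 *
      fderiv ℝ (fun β => policy β w.1 w.2) α (angleDirection i p))
      = M.A z.1 z.2 i *
        ∑ a, h ⟨i, a⟩ * fderiv ℝ (fun β => policy β i a) α (angleDirection i p) := fun z => by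
    rw [Fintype.sum_sigma, Finset.mul_sum, Finset.sum_eq_single i]
    · exact Finset.sum_congr rfl fun a _ => mul_left_comm _ _ _
    · intro j _ hj
      simp only [fderiv_policy_angleDirection_of_ne hj, mul_zero, Finset.sum_const_zero]
    · simp
  simp only [(hasFDerivAt_statCost hM hα hh).fderiv, sum_apply, smul_apply, smul_eq_mul, hinner,
    sum_mul_fderiv_policy_angleDirection hα]
  simp only [← mul_assoc, ← Finset.sum_mul]
  rw [← stateMass, statDist_eq_stateMass_mul_policy (hM α hα)]
  ring

/-- For the last angle of state `i`, both swapped actions contribute the same difference of `h`,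
and `cos α sin α (1 + tan² α) = tan α`. -/
theorem statDist_dotProduct_sum_phantomLaw_mul_weight (hM : (M.kernel α).IsIrreducible)
    (hα : α ∈ interior (angleBox d)) (i : S) (p : Fin (d i)) (h : StateAction d → ℝ) :
    M.statDist α ⬝ᵥ (fun z => ∑ a, phantomLaw α i p a *
        (weight α i p z * (h z - h ⟨i, phantomAction i p z a⟩)))
      = -Real.tan (α i p) * M.statDist α ⟨i, p.castSucc⟩ *
        (h ⟨i, p.castSucc⟩ - ∑ a, phantomLaw α i p a * h ⟨i, a⟩) := by
  by_cases hp : (p : ℕ) + 1 < d i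
  · simp only [sum_phantomLaw_mul_weight_of_lt hα hp]
    rw [dotProduct_visit_mul]
    ring
  · have hcos := (cos_pos_of_mem_interior_angleBox hα i p).ne'
    simp only [sum_phantomLaw_mul_weight_of_not_lt hα hp]
    rw [← Pi.add_def, dotProduct_add, dotProduct_visit_mul, dotProduct_visit_mul,
      phantomLaw_eq_single hα hp]
    simp only [statDist_eq_stateMass_mul_policy hM, policy_succ_of_not_lt hα hp, Pi.single_apply,
      ite_mul, one_mul, zero_mul, Finset.sum_ite_eq', Finset.mem_univ, if_true]
    have htrig : Real.cos (α i p) * Real.sin (α i p) * (1 + Real.tan (α i p) ^ 2)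
        = Real.tan (α i p) := by
      rw [← Real.tan_mul_cos hcos]
      linear_combination Real.tan (α i p) * Real.one_add_tan_sq_mul_cos_sq_eq_one hcos
    linear_combination (M.stateMass α i * policy α i p.castSucc *
      (h ⟨i, p.succ⟩ - h ⟨i, p.castSucc⟩)) * htrig

end Stationary

instance {S : Type*} {d : S → ℕ} : DiscreteMeasurableSpace (StateAction d) :=
  ⟨fun s => MeasurableSpace.measurableSet_iInf.2 fun i =>
    (MeasurableSet.of_discrete : MeasurableSet (Sigma.mk i ⁻¹' s))⟩

section Estimator

variable {S : Type*} [Fintype S] {d : S → ℕ} {M : MDP S d}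
  {α : Angles d} {Ω : Type*} [MeasurableSpace Ω] {μ : Measure Ω}
  [IsProbabilityMeasure μ] {Z : ℕ → Ω → StateAction d}

theorem IsTrajectory.ae_hittingSet_nonempty (hZ : M.IsTrajectory α μ Z)
    (hM : (M.kernel α).IsIrreducible) (i : S) (p : Fin (d i)) (Y : ℕ → Ω → Fin (d i + 1)) :
    ∀ᵐ ω ∂μ, ∀ k, (hittingSet i p (fun n => Z n ω) (fun n => Y n ω) k).Nonempty := by
  classical
  filter_upwards [(isMarkovChain_historyFiltration hZ.1 hZ.2).ae_exists_return hM
    (M.kernel_mem_rowStochastic α)] with ω hω k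
  exact hω _ k

variable [Nonempty (StateAction d)]

theorem IsTrajectory.ae_tendsto_average (hZ : M.IsTrajectory α μ Z)
    (hM : (M.kernel α).IsIrreducible) (c : StateAction d → ℝ) :
    ∀ᵐ ω ∂μ, Tendsto (fun N : ℕ => 1 / (N : ℝ) * ∑ n ∈ Finset.Icc 1 N, c (Z n ω)) atTop
      (𝓝 (M.statCost c α)) := by
  classical
  filter_upwards [ae_hasTimeAverage_of_isIrreducible (isMarkovChain_historyFiltration hZ.1 hZ.2) hM
    (M.kernel_mem_rowStochastic α) (isStationaryDistribution_statDist hM) c] with ω hω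
  exact hω.tendsto_sum_Icc

variable [DecidableEq S]

theorem IsPhantomSequence.ae_tendsto_wdPhantom {i : S} {p : Fin (d i)}
    {Y : ℕ → Ω → Fin (d i + 1)} (hY : IsPhantomSequence α i p μ Z Y)
    (hZ : M.IsTrajectory α μ Z) (hM : M.IsErgodic) (hα : α ∈ interior (angleBox d))
    (c : StateAction d → ℝ) :
    ∀ᵐ ω ∂μ, ∀ Γ : ℕ → ℝ, Tendsto Γ atTop (𝓝 (M.statCost c α)) →
      Tendsto (fun N => wdPhantom α c i p (fun n => Z n ω) (fun n => Y n ω) (Γ N) N) atTop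
        (𝓝 (fderiv ℝ (M.statCost c) α (angleDirection i p))) := by
  obtain ⟨hYm, hlaw, hind, hYZ⟩ := hY
  have hP := hM α hα
  obtain ⟨h, hh⟩ := exists_isPoissonSolution_statCost hP c
  have hchain := isMarkovChain_markedKernel hZ.1 hYm hZ.2 hlaw hind hYZ
  filter_upwards [ae_tendsto_phantomEstimator hchain (sum_phantomLaw hα i p) hP
    (M.kernel_mem_rowStochastic α) (isStationaryDistribution_statDist hP) hh
    (fun x => weight α i p x.1) fun x => ⟨i, phantomAction i p x.1 x.2⟩] with ω hω Γ hΓ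
  have hlim := (hω Γ hΓ).const_mul 2
  rw [statDist_dotProduct_sum_phantomLaw_mul_weight hP hα] at hlim
  simp only [← mul_assoc, mul_one_div] at hlim
  rw [fderiv_statCost_angleDirection hM hα hh]
  simp only [neg_mul, mul_neg] at hlim ⊢
  exact hlim

end Estimator

end MDP

theorem mainTheorem1 {S : Type*} [Fintype S] [DecidableEq S] {d : S → ℕ}
    (M : MDP S d) (hM : M.IsErgodic)
    (α : MDP.Angles d) (hα : α ∈ interior (MDP.angleBox d))
    (c : MDP.StateAction d → ℝ)
    {Ω : Type*} [MeasurableSpace Ω] (μ : Measure Ω) [IsProbabilityMeasure μ]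
    (Z : ℕ → Ω → MDP.StateAction d) (hZ : M.IsTrajectory α μ Z) :
    (∀ β ∈ interior (MDP.angleBox d), ∃! ϖ, M.IsInvariant β ϖ) ∧
    DifferentiableAt ℝ (M.statCost c) α ∧
    (∀ᵐ ω ∂μ, Tendsto (fun N : ℕ => 1 / (N : ℝ) * ∑ n ∈ Finset.Icc 1 N, c (Z n ω))
      atTop (𝓝 (M.statCost c α))) ∧
    ∀ (i : S) (p : Fin (d i)) (Y : ℕ → Ω → Fin (d i + 1)),
      MDP.IsPhantomSequence α i p μ Z Y →
      (∀ᵐ ω ∂μ, ∀ k, (MDP.hittingSet i p (fun n => Z n ω) (fun n => Y n ω) k).Nonempty) ∧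
      ∀ Γ : ℕ → Ω → ℝ,
        (∀ᵐ ω ∂μ, Tendsto (fun N => Γ N ω) atTop (𝓝 (M.statCost c α))) →
        ∀ᵐ ω ∂μ, Tendsto
          (fun N : ℕ => MDP.wdPhantom α c i p (fun n => Z n ω) (fun n => Y n ω) (Γ N ω) N)
          atTop (𝓝 (fderiv ℝ (M.statCost c) α (Pi.single i (Pi.single p 1)))) := by
  have hne : Nonempty (MDP.StateAction d) := (nonempty_of_isProbabilityMeasure μ).map (Z 0)
  have hP := hM α hα
  obtain ⟨h, hh⟩ := MDP.exists_isPoissonSolution_statCost hP c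
  refine ⟨fun β hβ => MDP.existsUnique_isInvariant (hM β hβ),
    (MDP.hasFDerivAt_statCost hM hα hh).differentiableAt, hZ.ae_tendsto_average hP c,
    fun i p Y hY => ⟨hZ.ae_hittingSet_nonempty hP i p Y, fun Γ hΓ => ?_⟩⟩
  filter_upwards [hY.ae_tendsto_wdPhantom hZ hM hα c, hΓ] with ω hω hΓω
  exact hω (fun N => Γ N ω) hΓω
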